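/- **Theorem.** Let $1 < p, q < \infty$, let $q'$ be the conjugate exponent of $q$ ($\frac1q+\frac1{q'}=1$), let $L$ be a (full-rank) lattice in $\mathbb{R}^d$ with dual lattice $L^\perp = \{\kappa \in \mathbb{R}^d : \kappa\cdot\lambda \in \mathbb{Z} \text{ for all } \lambda \in L\}$, and let $\Omega$ be a fundamental domain of $L$, i.e. a measurable set containing exactly one representative of each coset of $L$ in $\mathbb{R}^d$. Let $C^\infty(\Omega)$ be the space of smooth $L$-periodic functions $f:\mathbb{R}^d\to\mathbb{C}$, let $\widehat f(\kappa) = \frac{1}{|\Omega|}\int_\Omega f(x) e^{-2\pi i \kappa\cdot x}\,dx$ for $\kappa \in L^\perp$, and let $L^r(\Omega)$ be taken with respect to the normalized measure $dx/|\Omega|$. Let $A : C^\infty(\Omega) \to C^\infty(\Omega)$ be a Fourier multiplier with symbol $\sigma : L^\perp \to \mathbb{C}$, i.e. $\widehat{Af}(\kappa) = \sigma(\kappa)\widehat f(\kappa)$ for all $f \in C^\infty(\Omega)$ and $\kappa\in L^\perp$, and put $$\|A\|_{L^p\to L^q} := \sup_{0\neq f \in C^\infty(\Omega)} \frac{\|Af\|_{L^q(\Omega)}}{\|f\|_{L^p(\Omega)}},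 \qquad M_e(\sigma) := \sup_{s>0} s\,\bigl(\#\{\kappa\in L^\perp : |\sigma(\kappa)|\ge s\}\bigr)^{e},$$ where levels $s$ with $\{|\sigma|\ge s\}=\emptyset$ contribute $0$ and $\infty^0=1$, so that $M_0(\sigma) = \sup_{\kappa} |\sigma(\kappa)|$. There is a constant $C_{p,q}$ depending only on $p$ and $q$ (not on $d$, $L$, $\Omega$, $A$, $\sigma$) such that: 1. If $1 < p, q \le 2$ and $M_{1/p-1/2}(\sigma) < \infty$, then $\|A\|_{L^p\to L^q} \le C_{p,q}\, M_{1/p-1/2}(\sigma)$. 2. If $2 \le p, q < \infty$ and $M_{1/q'-1/2}(\sigma) < \infty$, then $\|A\|_{L^p\to L^q} \le C_{p,q}\, M_{1/q'-1/2}(\sigma)$. In particular, in each case $A$ extends to a bounded linear operator from $L^p(\Omega)$ to $L^q(\Omega)$. -/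

import Mathlib

open MeasureTheory
open scoped ENNReal NNReal ContDiff

noncomputable section

namespace LatticeFourier

variable {d : ℕ}

/-- A fundamental domain of the lattice `L`: a (Lebesgue) measurable set containing exactly one
representative of every coset of `L`, i.e. `∑_{l ∈ L} 1_Ω (x + l) = 1` for all `x`. -/
structure IsFundamentalDomain (L : Submodule ℤ (EuclideanSpace ℝ (Fin d)))
    (Ω : Set (EuclideanSpace ℝ (Fin d))) : Prop where
  measurable : NullMeasurableSet Ω volume
  existsUnique : ∀ x : EuclideanSpace ℝ (Fin d), ∃! l : L, x + (l : EuclideanSpace ℝ (Fin d)) ∈ Ω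

/-- The dual lattice `{κ | ∀ l ∈ L, κ · l ∈ ℤ}`. -/
def dualLattice (L : Submodule ℤ (EuclideanSpace ℝ (Fin d))) : Set (EuclideanSpace ℝ (Fin d)) :=
  {κ | ∀ l ∈ L, ∃ n : ℤ, inner ℝ κ l = (n : ℝ)}

/-- Normalized Lebesgue measure `dx / |Ω|` on `Ω`; the spaces `L^p(Ω)` are taken with respect
to it. -/
def normVol (Ω : Set (EuclideanSpace ℝ (Fin d))) : Measure (EuclideanSpace ℝ (Fin d)) :=
  (volume Ω)⁻¹ • volume.restrict Ω

/-- `C^∞(Ω)`: the smooth `L`-periodic functions on `ℝ^d`. -/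
def smoothPeriodic (L : Submodule ℤ (EuclideanSpace ℝ (Fin d))) :
    Submodule ℂ (EuclideanSpace ℝ (Fin d) → ℂ) where
  carrier := {f | ContDiff ℝ ∞ f ∧ ∀ x, ∀ l ∈ L, f (x + l) = f x}
  add_mem' := fun {f g} hf hg =>
    ⟨hf.1.add hg.1, fun x l hl => by simp [hf.2 x l hl, hg.2 x l hl]⟩
  zero_mem' := ⟨contDiff_const, fun _ _ _ => rfl⟩
  smul_mem' := fun c f hf =>
    ⟨contDiff_const.smul hf.1, fun x l hl => by simp [hf.2 x l hl]⟩

/-- The Fourier coefficient `|Ω|⁻¹ ∫_Ω f(x) e^{-2πi κ·x} dx`. -/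
def fourierCoefficient (Ω : Set (EuclideanSpace ℝ (Fin d))) (f : EuclideanSpace ℝ (Fin d) → ℂ)
    (κ : EuclideanSpace ℝ (Fin d)) : ℂ :=
  ∫ x, f x * Complex.exp (-(2 * Real.pi * Complex.I * ((inner ℝ κ x : ℝ) : ℂ))) ∂(normVol Ω)

/-- `A : C^∞(Ω) → C^∞(Ω)` is a Fourier multiplier with symbol `σ`. -/
def IsFourierMultiplier {L : Submodule ℤ (EuclideanSpace ℝ (Fin d))}
    (Ω : Set (EuclideanSpace ℝ (Fin d))) (A : smoothPeriodic L → smoothPeriodic L)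
    (σ : dualLattice L → ℂ) : Prop :=
  ∀ (f : smoothPeriodic L) (κ : dualLattice L),
    fourierCoefficient Ω (A f : EuclideanSpace ℝ (Fin d) → ℂ) κ =
      σ κ * fourierCoefficient Ω (f : EuclideanSpace ℝ (Fin d) → ℂ) κ

/-- `‖A‖_{L^p → L^q} = sup_{f ≠ 0} ‖A f‖_q / ‖f‖_p`, the supremum over `f ∈ C^∞(Ω)`. -/
def opNorm {L : Submodule ℤ (EuclideanSpace ℝ (Fin d))}
    (Ω : Set (EuclideanSpace ℝ (Fin d))) (p q : ℝ)
    (A : smoothPeriodic L → smoothPeriodic L) : ℝ≥0∞ :=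
  ⨆ (f : smoothPeriodic L) (_ : f ≠ 0),
    eLpNorm (A f : EuclideanSpace ℝ (Fin d) → ℂ) (ENNReal.ofReal q) (normVol Ω) /
      eLpNorm (f : EuclideanSpace ℝ (Fin d) → ℂ) (ENNReal.ofReal p) (normVol Ω)

/-- `A` extends to a bounded linear operator from `L^p(Ω)` to `L^q(Ω)`. -/
def HasBoundedExtension {L : Submodule ℤ (EuclideanSpace ℝ (Fin d))}
    (Ω : Set (EuclideanSpace ℝ (Fin d))) (p q : ℝ)
    (A : smoothPeriodic L → smoothPeriodic L) : Prop :=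
  ∃ T : Lp ℂ (ENNReal.ofReal p) (normVol Ω) →ₗ[ℂ] Lp ℂ (ENNReal.ofReal q) (normVol Ω),
    (∃ K : ℝ, ∀ u, ‖T u‖ ≤ K * ‖u‖) ∧
    ∀ f : smoothPeriodic L, ∃ u : Lp ℂ (ENNReal.ofReal p) (normVol Ω),
      u =ᵐ[normVol Ω] (f : EuclideanSpace ℝ (Fin d) → ℂ) ∧
      T u =ᵐ[normVol Ω] (A f : EuclideanSpace ℝ (Fin d) → ℂ)

/-- `sup_{s > 0} s (#{κ : |σ(κ)| ≥ s})^e`. Levels `s` with empty superlevel set contribute `0`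
(also for `e = 0`, where the quantity is therefore the supremum of `|σ|`); for `e > 0` this
restriction changes nothing. -/
def weakNorm {L : Submodule ℤ (EuclideanSpace ℝ (Fin d))} (σ : dualLattice L → ℂ) (e : ℝ) :
    ℝ≥0∞ :=
  ⨆ (s : ℝ) (_ : 0 < s) (_ : {κ : dualLattice L | s ≤ ‖σ κ‖}.Nonempty),
    ENNReal.ofReal s * (({κ : dualLattice L | s ≤ ‖σ κ‖}.encard : ℕ∞) : ℝ≥0∞) ^ e

end LatticeFourier

end

/-!
Paley's inequality: if `e` is an orthonormal system of functions bounded by `1` and `ρ ≥ 0`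
satisfies `#{i | u ≤ ρ i} ≤ u ^ (-p)` for all `u > 0`, where `1 < p < 2`, then
`∑ i, ρ i ^ (2 - p) |⟨e i, f⟩|² ≤ 2 / (p - 1)` whenever `‖f‖_p ≤ 1`. To see this, write the sum as
an integral over the levels `u` of `ρ` and split `f` at height `u⁻¹`: the part above is integrable,
so its coefficients are bounded and are summed by the cardinality hypothesis, while the part below
is square integrable and is handled by Bessel's inequality. With `ρ` a power of
`|σ| / M_{1/p - 1/2}(σ)` this bounds the multiplier with symbol `σ` from `L^p` to `L²`, which is
contained in `L^q` for `q ≤ 2`; for `p = 2` Bessel's inequality suffices.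

For `p, q ≥ 2` the image of `f` is paired with `g ∈ L^{q'}`: by Parseval and Cauchy–Schwarz the
pairing is at most `‖f‖_2` times the `ℓ²` norm of the coefficients of `g` multiplied by the
conjugate of `σ`, and the first case applies to `g`. A smooth periodic function lies in the closed
span of the characters, so `A f` is recovered from its Fourier coefficients.
-/

noncomputable section

namespace LatticeFourier

section WeakQuasinorm

variable {ι E : Type*} [SeminormedAddGroup E] {c : ι → E} {a : ℝ}

/-- The quasinorm `M_a` of weak `ℓ^{1/a}` on an arbitrary index set; on a dual lattice it is
`weakNorm`. -/
def weakQuasinorm (c : ι → E) (a : ℝ) : ℝ≥0∞ :=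
  ⨆ (s : ℝ) (_ : 0 < s) (_ : {i | s ≤ ‖c i‖}.Nonempty),
    ENNReal.ofReal s * (({i | s ≤ ‖c i‖}.encard : ℕ∞) : ℝ≥0∞) ^ a

lemma ofReal_mul_encard_rpow_le_weakQuasinorm {s : ℝ} (hs : 0 < s)
    (h : {i | s ≤ ‖c i‖}.Nonempty) :
    ENNReal.ofReal s * (({i | s ≤ ‖c i‖}.encard : ℕ∞) : ℝ≥0∞) ^ a ≤ weakQuasinorm c a :=
  le_iSup_of_le s (le_iSup_of_le hs (le_iSup_of_le h le_rfl))

lemma enorm_le_weakQuasinorm (ha : 0 ≤ a) (i : ι) : ‖c i‖ₑ ≤ weakQuasinorm c a := by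
  rcases (norm_nonneg (c i)).eq_or_lt with h | hpos
  · rw [← ofReal_norm, ← h]
    simp
  have hne : {j | ‖c i‖ ≤ ‖c j‖}.Nonempty := ⟨i, le_refl ‖c i‖⟩
  have hcard : (1 : ℝ≥0∞) ≤ (({j | ‖c i‖ ≤ ‖c j‖}.encard : ℕ∞) : ℝ≥0∞) := by
    exact_mod_cast Set.one_le_encard_iff_nonempty.2 hne
  calc ‖c i‖ₑ = ENNReal.ofReal ‖c i‖ * 1 := by rw [mul_one, ofReal_norm]
    _ ≤ ENNReal.ofReal ‖c i‖ * (({j | ‖c i‖ ≤ ‖c j‖}.encard : ℕ∞) : ℝ≥0∞) ^ a := by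
      gcongr
      simpa using ENNReal.rpow_le_rpow hcard ha
    _ ≤ weakQuasinorm c a := ofReal_mul_encard_rpow_le_weakQuasinorm hpos hne

lemma encard_le_rpow_of_weakQuasinorm_le (ha : 0 < a) {N u : ℝ} (hN : 0 < N) (hu : 0 < u)
    (h : weakQuasinorm c a ≤ ENNReal.ofReal N) :
    (({i | N * u ≤ ‖c i‖}.encard : ℕ∞) : ℝ≥0∞) ≤ ENNReal.ofReal (u ^ (-a⁻¹)) := by
  rcases Set.eq_empty_or_nonempty {i | N * u ≤ ‖c i‖} with hempty | hne
  · simp [hempty]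
  have hNu : 0 < N * u := by positivity
  have hlevel := (ofReal_mul_encard_rpow_le_weakQuasinorm (a := a) hNu hne).trans h
  rw [mul_comm, ← ENNReal.le_div_iff_mul_le (by simp [hNu]) (by simp),
    ← ENNReal.ofReal_div_of_pos hNu, div_mul_cancel_left₀ hN.ne'] at hlevel
  calc (({i | N * u ≤ ‖c i‖}.encard : ℕ∞) : ℝ≥0∞)
      = ((({i | N * u ≤ ‖c i‖}.encard : ℕ∞) : ℝ≥0∞) ^ a) ^ a⁻¹ := by
        rw [← ENNReal.rpow_mul, mul_inv_cancel₀ ha.ne', ENNReal.rpow_one]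
    _ ≤ ENNReal.ofReal u⁻¹ ^ a⁻¹ := ENNReal.rpow_le_rpow hlevel (inv_nonneg.2 ha.le)
    _ = ENNReal.ofReal (u ^ (-a⁻¹)) := by
        rw [ENNReal.ofReal_rpow_of_pos (by positivity), Real.inv_rpow hu.le, Real.rpow_neg hu.le]

end WeakQuasinorm

section LayerCake

variable {X : Type*} [MeasurableSpace X] {μ : Measure X}

lemma lintegral_mul_ofReal_rpow_eq_meas_le {w : X → ℝ≥0∞} (hw : AEMeasurable w μ) {φ : X → ℝ}
    (hφ0 : 0 ≤ φ) (hφ : AEMeasurable φ μ) {r : ℝ} (hr : 0 < r) :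
    ∫⁻ x, w x * ENNReal.ofReal (φ x ^ r) ∂μ =
      ENNReal.ofReal r * ∫⁻ t in Set.Ioi (0 : ℝ),
        ENNReal.ofReal (t ^ (r - 1)) * ∫⁻ x in {x | t ≤ φ x}, w x ∂μ := by
  have hcake := lintegral_rpow_eq_lintegral_meas_le_mul (μ.withDensity w) (ae_of_all _ hφ0)
    (hφ.mono_ac (withDensity_absolutelyContinuous μ w)) hr
  rw [lintegral_withDensity_eq_lintegral_mul₀ hw (hφ.pow_const r).ennreal_ofReal] at hcake
  refine hcake.trans (congrArg _ (lintegral_congr fun t => ?_))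
  rw [mul_comm, withDensity_apply₀ _ (nullMeasurableSet_le aemeasurable_const hφ)]

lemma lintegral_mul_ofReal_rpow_eq_meas_lt {w : X → ℝ≥0∞} (hw : AEMeasurable w μ) {φ : X → ℝ}
    (hφ0 : 0 ≤ φ) (hφ : AEMeasurable φ μ) {r : ℝ} (hr : 0 < r) :
    ∫⁻ x, w x * ENNReal.ofReal (φ x ^ r) ∂μ =
      ENNReal.ofReal r * ∫⁻ t in Set.Ioi (0 : ℝ),
        ENNReal.ofReal (t ^ (r - 1)) * ∫⁻ x in {x | t < φ x}, w x ∂μ := by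
  have hcake := lintegral_rpow_eq_lintegral_meas_lt_mul (μ.withDensity w) (ae_of_all _ hφ0)
    (hφ.mono_ac (withDensity_absolutelyContinuous μ w)) hr
  rw [lintegral_withDensity_eq_lintegral_mul₀ hw (hφ.pow_const r).ennreal_ofReal] at hcake
  refine hcake.trans (congrArg _ (lintegral_congr fun t => ?_))
  rw [mul_comm, withDensity_apply₀ _ (nullMeasurableSet_lt aemeasurable_const hφ)]

lemma antitone_setLIntegral_gt (w : X → ℝ≥0∞) (φ : X → ℝ) :
    Antitone fun t : ℝ => ∫⁻ x in {x | t < φ x}, w x ∂μ :=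
  fun _ _ hst => lintegral_mono_set fun _ hx => hst.trans_lt hx

lemma lintegral_Ioi_comp_inv (g : ℝ → ℝ≥0∞) :
    ∫⁻ u in Set.Ioi (0 : ℝ), g u⁻¹ =
      ∫⁻ t in Set.Ioi (0 : ℝ), ENNReal.ofReal (t ^ (-2 : ℝ)) * g t := by
  have himage : (fun t : ℝ => t⁻¹) '' Set.Ioi 0 = Set.Ioi 0 := by
    ext u
    simp
  conv_lhs => rw [← himage]
  rw [lintegral_image_eq_lintegral_abs_deriv_mul measurableSet_Ioi
    (fun t ht => (hasDerivAt_inv (ne_of_gt ht)).hasDerivWithinAt) inv_injective.injOn]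
  refine setLIntegral_congr_fun measurableSet_Ioi fun t (ht : 0 < t) => ?_
  simp only [inv_inv, abs_neg, abs_inv, abs_pow, abs_of_pos ht]
  rw [Real.rpow_neg ht.le, Real.rpow_two]

variable {E : Type*} [NormedAddCommGroup E] {f : X → E} {p : ℝ}

lemma setLIntegral_enorm_norm_gt_le (hp : 1 ≤ p) (hf : AEStronglyMeasurable f μ) {t : ℝ}
    (ht : 0 < t) :
    ∫⁻ x in {x | t < ‖f x‖}, ‖f x‖ₑ ∂μ ≤
      ENNReal.ofReal (t ^ (1 - p)) * ∫⁻ x, ‖f x‖ₑ ^ p ∂μ := by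
  rw [← lintegral_const_mul'' _ (hf.enorm.pow_const p)]
  refine (lintegral_mono_ae ?_).trans (setLIntegral_le_lintegral {x | t < ‖f x‖} _)
  rw [ae_restrict_iff'₀ (nullMeasurableSet_lt aemeasurable_const hf.norm.aemeasurable)]
  refine ae_of_all _ fun x (hx : t < ‖f x‖) => ?_
  have hfx : 0 < ‖f x‖ := ht.trans hx
  rw [← ofReal_norm, ENNReal.ofReal_rpow_of_pos hfx, ← ENNReal.ofReal_mul (by positivity)]
  refine ENNReal.ofReal_le_ofReal ?_
  calc ‖f x‖ = ‖f x‖ ^ (1 - p) * ‖f x‖ ^ p := by rw [← Real.rpow_add hfx]; simp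
    _ ≤ t ^ (1 - p) * ‖f x‖ ^ p := by
      gcongr ?_ * _
      exact Real.rpow_le_rpow_of_nonpos ht hx.le (by linarith)

lemma lintegral_rpow_mul_setLIntegral_enorm (hp : 1 < p) (hf : AEStronglyMeasurable f μ) :
    ∫⁻ u in Set.Ioi (0 : ℝ), ENNReal.ofReal (u ^ (-p)) * ∫⁻ x in {x | u⁻¹ < ‖f x‖}, ‖f x‖ₑ ∂μ =
      ENNReal.ofReal (p - 1)⁻¹ * ∫⁻ x, ‖f x‖ₑ ^ p ∂μ := by
  have hp1 : 0 < p - 1 := by linarith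
  have hpow (x : X) : ‖f x‖ₑ * ENNReal.ofReal (‖f x‖ ^ (p - 1)) = ‖f x‖ₑ ^ p := by
    rw [← ENNReal.ofReal_rpow_of_nonneg (norm_nonneg _) hp1.le, ofReal_norm]
    nth_rw 1 [← ENNReal.rpow_one ‖f x‖ₑ]
    rw [← ENNReal.rpow_add_of_nonneg _ _ zero_le_one hp1.le, add_sub_cancel]
  have hcake := lintegral_mul_ofReal_rpow_eq_meas_lt hf.enorm (fun x => norm_nonneg (f x))
    hf.norm.aemeasurable hp1
  simp only [hpow] at hcake
  rw [hcake, ← mul_assoc, ← ENNReal.ofReal_mul (by positivity), inv_mul_cancel₀ hp1.ne',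
    ENNReal.ofReal_one, one_mul]
  calc ∫⁻ u in Set.Ioi (0 : ℝ),
        ENNReal.ofReal (u ^ (-p)) * ∫⁻ x in {x | u⁻¹ < ‖f x‖}, ‖f x‖ₑ ∂μ
      = ∫⁻ u in Set.Ioi (0 : ℝ),
          ENNReal.ofReal (u⁻¹ ^ p) * ∫⁻ x in {x | u⁻¹ < ‖f x‖}, ‖f x‖ₑ ∂μ :=
        setLIntegral_congr_fun measurableSet_Ioi fun u (hu : 0 < u) => by
          simp only [Real.rpow_neg hu.le, Real.inv_rpow hu.le]
    _ = ∫⁻ t in Set.Ioi (0 : ℝ), ENNReal.ofReal (t ^ (-2 : ℝ)) *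
          (ENNReal.ofReal (t ^ p) * ∫⁻ x in {x | t < ‖f x‖}, ‖f x‖ₑ ∂μ) :=
        lintegral_Ioi_comp_inv fun t =>
          ENNReal.ofReal (t ^ p) * ∫⁻ x in {x | t < ‖f x‖}, ‖f x‖ₑ ∂μ
    _ = ∫⁻ t in Set.Ioi (0 : ℝ),
          ENNReal.ofReal (t ^ (p - 1 - 1)) * ∫⁻ x in {x | t < ‖f x‖}, ‖f x‖ₑ ∂μ :=
        setLIntegral_congr_fun measurableSet_Ioi fun t (ht : 0 < t) => by
          rw [← mul_assoc, ← ENNReal.ofReal_mul (by positivity), ← Real.rpow_add ht]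
          ring_nf

lemma lintegral_rpow_mul_setLIntegral_enorm_sq (hp0 : 0 < p) (hp : p < 2)
    (hf : AEStronglyMeasurable f μ) :
    ∫⁻ u in Set.Ioi (0 : ℝ),
        ENNReal.ofReal (u ^ (1 - p)) * ∫⁻ x in {x | ‖f x‖ ≤ u⁻¹}, ‖f x‖ₑ ^ 2 ∂μ =
      ENNReal.ofReal (2 - p)⁻¹ * ∫⁻ x, ‖f x‖ₑ ^ p ∂μ := by
  have h2p : 0 < 2 - p := by linarith
  have hpow (x : X) : ‖f x‖ₑ ^ 2 * ENNReal.ofReal (‖f x‖⁻¹ ^ (2 - p)) = ‖f x‖ₑ ^ p := by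
    rcases (norm_nonneg (f x)).eq_or_lt with h | h
    · simp [norm_eq_zero.1 h.symm, hp0]
    rw [← ofReal_norm, ← ENNReal.ofReal_pow h.le, ← ENNReal.ofReal_mul (by positivity),
      ENNReal.ofReal_rpow_of_pos h, Real.inv_rpow h.le, ← Real.rpow_neg h.le,
      ← Real.rpow_two, ← Real.rpow_add h]
    ring_nf
  have hcake := lintegral_mul_ofReal_rpow_eq_meas_le (hf.enorm.pow_const 2)
    (fun x => inv_nonneg.2 (norm_nonneg (f x))) hf.norm.aemeasurable.inv h2p
  simp only [hpow] at hcake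
  rw [hcake, ← mul_assoc, ← ENNReal.ofReal_mul (by positivity), inv_mul_cancel₀ h2p.ne',
    ENNReal.ofReal_one, one_mul]
  refine setLIntegral_congr_fun measurableSet_Ioi fun u (hu : 0 < u) => ?_
  have hexponent : 2 - p - 1 = 1 - p := by ring
  have hinv : AEMeasurable (fun x => ‖f x‖⁻¹) μ := hf.norm.aemeasurable.inv
  rw [hexponent, ← lintegral_indicator₀ (nullMeasurableSet_le aemeasurable_const hinv),
    ← lintegral_indicator₀ (nullMeasurableSet_le hf.norm.aemeasurable aemeasurable_const)]
  congr 1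
  refine lintegral_congr fun x => ?_
  rcases (norm_nonneg (f x)).eq_or_lt with h | h
  · simp [Set.indicator_apply, norm_eq_zero.1 h.symm]
  · simp only [Set.indicator_apply, Set.mem_ofPred_eq, le_inv_comm₀ hu h]

lemma lintegral_rpow_mul_setLIntegral_add (hp : 1 < p) (hp2 : p < 2)
    (hf : AEStronglyMeasurable f μ) :
    ∫⁻ u in Set.Ioi (0 : ℝ),
        (2 * (ENNReal.ofReal (u ^ (-p)) * ∫⁻ x in {x | u⁻¹ < ‖f x‖}, ‖f x‖ₑ ∂μ) +
          2 * (ENNReal.ofReal (u ^ (1 - p)) * ∫⁻ x in {x | ‖f x‖ ≤ u⁻¹}, ‖f x‖ₑ ^ 2 ∂μ)) =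
      2 * ENNReal.ofReal ((p - 1)⁻¹ + (2 - p)⁻¹) * ∫⁻ x, ‖f x‖ₑ ^ p ∂μ := by
  have hlarge : Measurable fun u : ℝ =>
      ENNReal.ofReal (u ^ (-p)) * ∫⁻ x in {x | u⁻¹ < ‖f x‖}, ‖f x‖ₑ ∂μ :=
    Measurable.mul (by fun_prop)
      ((antitone_setLIntegral_gt _ _).measurable.comp measurable_inv)
  rw [lintegral_add_left (hlarge.const_mul 2), lintegral_const_mul' _ _ (by simp),
    lintegral_const_mul' _ _ (by simp), lintegral_rpow_mul_setLIntegral_enorm hp hf,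
    lintegral_rpow_mul_setLIntegral_enorm_sq (by linarith) hp2 hf,
    ENNReal.ofReal_add (inv_nonneg.2 (by linarith)) (inv_nonneg.2 (by linarith))]
  ring

end LayerCake

lemma eLpNorm_two_sq {X E : Type*} [MeasurableSpace X] [NormedAddCommGroup E] {μ : Measure X}
    (f : X → E) : eLpNorm f 2 μ ^ 2 = ∫⁻ x, ‖f x‖ₑ ^ 2 ∂μ := by
  simpa using eLpNorm_nnreal_pow_eq_lintegral (f := f) (μ := μ) (p := 2) two_ne_zero

lemma eLpNorm_ofReal_rpow {X E : Type*} [MeasurableSpace X] [NormedAddCommGroup E] {μ : Measure X}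
    {p : ℝ} (hp : 0 < p) (f : X → E) :
    eLpNorm f (ENNReal.ofReal p) μ ^ p = ∫⁻ x, ‖f x‖ₑ ^ p ∂μ := by
  have h := eLpNorm_nnreal_pow_eq_lintegral (f := f) (μ := μ) (p := p.toNNReal) (by simpa using hp)
  rwa [Real.coe_toNNReal _ hp.le] at h

section Coefficients

variable {𝕜 X ι : Type*} [RCLike 𝕜] [MeasurableSpace X] {μ : Measure X} {e : ι → Lp 𝕜 2 μ}
  {f g : X → 𝕜}

/-- The coefficients of `f` in the system `e`. They are defined by an integral rather than by the
inner product of `L²` so that they make sense for every integrable `f` when `e` is bounded. -/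
def coeff (e : ι → Lp 𝕜 2 μ) (f : X → 𝕜) (i : ι) : 𝕜 := ∫ x, inner 𝕜 (e i x) (f x) ∂μ

/-- An orthonormal system in `L²` of functions bounded by `1`, the setting of Paley's inequality. -/
structure BoundedOrthonormal (e : ι → Lp 𝕜 2 μ) : Prop where
  orthonormal : Orthonormal 𝕜 e
  norm_le_one : ∀ i, ∀ᵐ x ∂μ, ‖e i x‖ ≤ 1

lemma coeff_congr_ae (h : f =ᵐ[μ] g) (i : ι) : coeff e f i = coeff e g i :=
  integral_congr_ae (h.mono fun x hx => by simp only [hx])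

lemma coeff_smul (c : 𝕜) (f : X → 𝕜) (i : ι) : coeff e (c • f) i = c * coeff e f i := by
  simp only [coeff, Pi.smul_apply, inner_smul_right, integral_const_mul]

lemma coeff_eq_inner (hf : MemLp f 2 μ) (i : ι) : coeff e f i = inner 𝕜 (e i) (hf.toLp f) := by
  rw [L2.inner_def]
  exact coeff_congr_ae hf.coeFn_toLp.symm i

namespace BoundedOrthonormal

variable (he : BoundedOrthonormal e)
include he

lemma integrable_inner (hf : Integrable f μ) (i : ι) :
    Integrable (fun x => inner 𝕜 (e i x) (f x)) μ :=
  hf.norm.mono ((Lp.aestronglyMeasurable (e i)).inner hf.1) <| by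
    filter_upwards [he.norm_le_one i] with x hx
    calc ‖inner 𝕜 (e i x) (f x)‖ ≤ ‖e i x‖ * ‖f x‖ := norm_inner_le_norm _ _
      _ ≤ 1 * ‖f x‖ := by gcongr
      _ = ‖‖f x‖‖ := by simp

lemma coeff_add (hf : Integrable f μ) (hg : Integrable g μ) (i : ι) :
    coeff e (f + g) i = coeff e f i + coeff e g i := by
  simp only [coeff, Pi.add_apply, inner_add_right]
  exact integral_add (he.integrable_inner hf i) (he.integrable_inner hg i)

lemma enorm_coeff_le (f : X → 𝕜) (i : ι) : ‖coeff e f i‖ₑ ≤ ∫⁻ x, ‖f x‖ₑ ∂μ := by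
  refine (enorm_integral_le_lintegral_enorm _).trans (lintegral_mono_ae ?_)
  filter_upwards [he.norm_le_one i] with x hx
  rw [← ofReal_norm, ← ofReal_norm]
  refine ENNReal.ofReal_le_ofReal ((norm_inner_le_norm _ _).trans ?_)
  exact mul_le_of_le_one_left (norm_nonneg _) hx

lemma sum_enorm_coeff_sq_le (hf : MemLp f 2 μ) (S : Finset ι) :
    ∑ i ∈ S, ‖coeff e f i‖ₑ ^ 2 ≤ ∫⁻ x, ‖f x‖ₑ ^ 2 ∂μ := by
  have hbessel := he.orthonormal.sum_inner_products_le (hf.toLp f) (s := S)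
  simp only [← coeff_eq_inner hf] at hbessel
  calc ∑ i ∈ S, ‖coeff e f i‖ₑ ^ 2 = ENNReal.ofReal (∑ i ∈ S, ‖coeff e f i‖ ^ 2) := by
        rw [ENNReal.ofReal_sum_of_nonneg fun i _ => sq_nonneg _]
        simp only [ENNReal.ofReal_pow (norm_nonneg _), ofReal_norm]
    _ ≤ ENNReal.ofReal (‖hf.toLp f‖ ^ 2) := ENNReal.ofReal_le_ofReal hbessel
    _ = ∫⁻ x, ‖f x‖ₑ ^ 2 ∂μ := by
        rw [ENNReal.ofReal_pow (norm_nonneg _), ofReal_norm, Lp.enorm_toLp, eLpNorm_two_sq]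

lemma enorm_coeff_sq_le_add (hf : Integrable f μ) {B : Set X} (hB : NullMeasurableSet B μ)
    (i : ι) :
    ‖coeff e f i‖ₑ ^ 2 ≤
      2 * (∫⁻ x in B, ‖f x‖ₑ ∂μ) ^ 2 + 2 * ‖coeff e (Bᶜ.indicator f) i‖ₑ ^ 2 := by
  have hlarge : ‖coeff e (B.indicator f) i‖ₑ ≤ ∫⁻ x in B, ‖f x‖ₑ ∂μ := by
    refine (he.enorm_coeff_le _ i).trans_eq ?_
    simp only [enorm_indicator_eq_indicator_enorm, lintegral_indicator₀ hB]
  calc ‖coeff e f i‖ₑ ^ 2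
    _ = ‖coeff e (B.indicator f) i + coeff e (Bᶜ.indicator f) i‖ₑ ^ 2 := by
        rw [← he.coeff_add (hf.indicator₀ hB) (hf.indicator₀ hB.compl),
          Set.indicator_self_add_compl]
    _ ≤ (∫⁻ x in B, ‖f x‖ₑ ∂μ + ‖coeff e (Bᶜ.indicator f) i‖ₑ) ^ 2 := by
        gcongr
        exact (enorm_add_le _ _).trans (add_le_add_left hlarge _)
    _ ≤ 2 * (∫⁻ x in B, ‖f x‖ₑ ∂μ) ^ 2 + 2 * ‖coeff e (Bᶜ.indicator f) i‖ₑ ^ 2 := by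
        have h := ENNReal.rpow_add_le_mul_rpow_add_rpow
          (∫⁻ x in B, ‖f x‖ₑ ∂μ) ‖coeff e (Bᶜ.indicator f) i‖ₑ (one_le_two (α := ℝ))
        have hexp : (2 : ℝ≥0∞) ^ ((2 : ℝ) - 1) = 2 := by norm_num
        rwa [hexp, ENNReal.rpow_ofNat, ENNReal.rpow_ofNat, ENNReal.rpow_ofNat, mul_add] at h

lemma sum_enorm_coeff_sq_le_add (hf : Integrable f μ) {B : Set X} (hB : NullMeasurableSet B μ)
    (hfB : MemLp (Bᶜ.indicator f) 2 μ) (S : Finset ι) :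
    ∑ i ∈ S, ‖coeff e f i‖ₑ ^ 2 ≤
      2 * (S.card * (∫⁻ x in B, ‖f x‖ₑ ∂μ) ^ 2) + 2 * ∫⁻ x in Bᶜ, ‖f x‖ₑ ^ 2 ∂μ := by
  calc ∑ i ∈ S, ‖coeff e f i‖ₑ ^ 2
    _ ≤ ∑ i ∈ S, (2 * (∫⁻ x in B, ‖f x‖ₑ ∂μ) ^ 2 + 2 * ‖coeff e (Bᶜ.indicator f) i‖ₑ ^ 2) :=
        Finset.sum_le_sum fun i _ => he.enorm_coeff_sq_le_add hf hB i
    _ = 2 * (S.card * (∫⁻ x in B, ‖f x‖ₑ ∂μ) ^ 2) +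
          2 * ∑ i ∈ S, ‖coeff e (Bᶜ.indicator f) i‖ₑ ^ 2 := by
        rw [Finset.sum_add_distrib, Finset.sum_const, nsmul_eq_mul, Finset.mul_sum]
        ring
    _ ≤ 2 * (S.card * (∫⁻ x in B, ‖f x‖ₑ ∂μ) ^ 2) + 2 * ∫⁻ x in Bᶜ, ‖f x‖ₑ ^ 2 ∂μ := by
        gcongr
        refine (he.sum_enorm_coeff_sq_le hfB S).trans_eq ?_
        rw [← lintegral_indicator₀ hB.compl]
        refine lintegral_congr fun x => ?_
        by_cases hx : x ∈ Bᶜ <;> simp only [hx, Set.indicator_of_mem, Set.indicator_of_notMem,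
          not_false_eq_true, enorm_zero, ne_eq, OfNat.ofNat_ne_zero, zero_pow]

lemma sum_enorm_coeff_sq_le_of_height (hf : Integrable f μ) (t : ℝ) (S : Finset ι) :
    ∑ i ∈ S, ‖coeff e f i‖ₑ ^ 2 ≤
      2 * (S.card * (∫⁻ x in {x | t < ‖f x‖}, ‖f x‖ₑ ∂μ) ^ 2) +
        2 * ∫⁻ x in {x | ‖f x‖ ≤ t}, ‖f x‖ₑ ^ 2 ∂μ := by
  have hcompl : {x | t < ‖f x‖}ᶜ = {x | ‖f x‖ ≤ t} := by ext x; simp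
  have hB : NullMeasurableSet {x | t < ‖f x‖} μ :=
    nullMeasurableSet_lt aemeasurable_const hf.1.norm.aemeasurable
  have hsmall : Integrable ({x | ‖f x‖ ≤ t}.indicator f) μ :=
    hcompl ▸ hf.indicator₀ hB.compl
  have hsmall_le (x : X) : ‖‖{x | ‖f x‖ ≤ t}.indicator f x‖‖ ≤ |t| := by
    rw [Set.indicator_apply]
    split_ifs with hx
    · simpa using le_trans hx (le_abs_self t)
    · simp
  rw [← hcompl]
  refine he.sum_enorm_coeff_sq_le_add hf hB ?_ S
  rw [hcompl, memLp_two_iff_integrable_sq_norm hsmall.1]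
  simpa only [sq] using hsmall.norm.bdd_mul hsmall.1.norm (ae_of_all _ hsmall_le)

end BoundedOrthonormal

end Coefficients

lemma sum_mul_ofReal_rpow_eq_lintegral {ι : Type*} (S : Finset ι) (w : ι → ℝ≥0∞) {ρ : ι → ℝ}
    (hρ : 0 ≤ ρ) {r : ℝ} (hr : 0 < r) :
    ∑ i ∈ S, w i * ENNReal.ofReal (ρ i ^ r) =
      ENNReal.ofReal r * ∫⁻ t in Set.Ioi (0 : ℝ),
        ENNReal.ofReal (t ^ (r - 1)) * ∑ i ∈ S with t ≤ ρ i, w i := by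
  classical
  let _ : MeasurableSpace ι := ⊤
  have hsum (T : Finset ι) (g : ι → ℝ≥0∞) : ∫⁻ i in T, g i ∂Measure.count = ∑ i ∈ T, g i := by
    simp [lintegral_finset]
  have hcake := lintegral_mul_ofReal_rpow_eq_meas_le (μ := Measure.count.restrict (S : Set ι))
    (measurable_from_top (f := w)).aemeasurable hρ measurable_from_top.aemeasurable hr
  rw [hsum] at hcake
  refine hcake.trans (congrArg _ (lintegral_congr fun t => ?_))
  rw [Measure.restrict_restrict MeasurableSpace.measurableSet_top, ← hsum, Finset.coe_filter,
    Set.inter_comm]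
  rfl

namespace BoundedOrthonormal

variable {𝕜 X ι : Type*} [RCLike 𝕜] [MeasurableSpace X] {μ : Measure X} {e : ι → Lp 𝕜 2 μ}
  {f : X → 𝕜} {p : ℝ}

section Normalized

variable {ρ : ι → ℝ}
  (hρcard : ∀ u > 0, (({i | u ≤ ρ i}.encard : ℕ∞) : ℝ≥0∞) ≤ ENNReal.ofReal (u ^ (-p)))
  (hnorm : ∫⁻ x, ‖f x‖ₑ ^ p ∂μ ≤ 1)
include hρcard hnorm

lemma rpow_mul_sum_enorm_coeff_sq_le (he : BoundedOrthonormal e) (hp : 1 ≤ p)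
    (hf : Integrable f μ) (S : Finset ι) {u : ℝ} (hu : 0 < u) :
    ENNReal.ofReal (u ^ (1 - p)) * ∑ i ∈ S with u ≤ ρ i, ‖coeff e f i‖ₑ ^ 2 ≤
      2 * (ENNReal.ofReal (u ^ (-p)) * ∫⁻ x in {x | u⁻¹ < ‖f x‖}, ‖f x‖ₑ ∂μ) +
        2 * (ENNReal.ofReal (u ^ (1 - p)) * ∫⁻ x in {x | ‖f x‖ ≤ u⁻¹}, ‖f x‖ₑ ^ 2 ∂μ) := by
  set G := ∫⁻ x in {x | u⁻¹ < ‖f x‖}, ‖f x‖ₑ ∂μ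
  set H := ∫⁻ x in {x | ‖f x‖ ≤ u⁻¹}, ‖f x‖ₑ ^ 2 ∂μ
  have hcard : ((S.filter (u ≤ ρ ·)).card : ℝ≥0∞) ≤ ENNReal.ofReal (u ^ (-p)) := by
    refine le_trans ?_ (hρcard u hu)
    have hsub : ((S.filter (u ≤ ρ ·) : Finset ι) : Set ι).encard ≤ {i | u ≤ ρ i}.encard :=
      Set.encard_le_encard fun i hi => (Finset.mem_filter.1 hi).2
    rw [Set.encard_coe_eq_coe_finsetCard] at hsub
    exact_mod_cast hsub
  have hG : ENNReal.ofReal (u ^ (1 - p)) * G ≤ 1 := by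
    calc ENNReal.ofReal (u ^ (1 - p)) * G
      _ ≤ ENNReal.ofReal (u ^ (1 - p)) * (ENNReal.ofReal (u⁻¹ ^ (1 - p)) * 1) := by
          gcongr
          refine (setLIntegral_enorm_norm_gt_le hp hf.1 (inv_pos.2 hu)).trans ?_
          gcongr
      _ = 1 := by
          rw [mul_one, ← ENNReal.ofReal_mul (by positivity),
            ← Real.mul_rpow hu.le (inv_nonneg.2 hu.le), mul_inv_cancel₀ hu.ne', Real.one_rpow,
            ENNReal.ofReal_one]
  calc ENNReal.ofReal (u ^ (1 - p)) * ∑ i ∈ S with u ≤ ρ i, ‖coeff e f i‖ₑ ^ 2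
    _ ≤ ENNReal.ofReal (u ^ (1 - p)) * (2 * (ENNReal.ofReal (u ^ (-p)) * G ^ 2) + 2 * H) := by
        gcongr
        refine (he.sum_enorm_coeff_sq_le_of_height hf u⁻¹ _).trans ?_
        gcongr
    _ = 2 * (ENNReal.ofReal (u ^ (-p)) * G * (ENNReal.ofReal (u ^ (1 - p)) * G)) +
          2 * (ENNReal.ofReal (u ^ (1 - p)) * H) := by ring
    _ ≤ 2 * (ENNReal.ofReal (u ^ (-p)) * G * 1) + 2 * (ENNReal.ofReal (u ^ (1 - p)) * H) := by
        gcongr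
    _ = _ := by rw [mul_one]

lemma sum_enorm_coeff_sq_mul_rpow_le (he : BoundedOrthonormal e) (hp : 1 < p) (hp2 : p < 2)
    (hf : Integrable f μ) (hρ : 0 ≤ ρ) (S : Finset ι) :
    ∑ i ∈ S, ‖coeff e f i‖ₑ ^ 2 * ENNReal.ofReal (ρ i ^ (2 - p)) ≤
      ENNReal.ofReal (2 / (p - 1)) := by
  have hp1 : 0 < p - 1 := by linarith
  have h2p : 0 < 2 - p := by linarith
  have hexponent : 2 - p - 1 = 1 - p := by ring
  calc ∑ i ∈ S, ‖coeff e f i‖ₑ ^ 2 * ENNReal.ofReal (ρ i ^ (2 - p))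
    _ = ENNReal.ofReal (2 - p) * ∫⁻ u in Set.Ioi (0 : ℝ),
          ENNReal.ofReal (u ^ (1 - p)) * ∑ i ∈ S with u ≤ ρ i, ‖coeff e f i‖ₑ ^ 2 := by
        rw [sum_mul_ofReal_rpow_eq_lintegral S _ hρ h2p, hexponent]
    _ ≤ ENNReal.ofReal (2 - p) * (2 * ENNReal.ofReal ((p - 1)⁻¹ + (2 - p)⁻¹) *
          ∫⁻ x, ‖f x‖ₑ ^ p ∂μ) := by
        rw [← lintegral_rpow_mul_setLIntegral_add hp hp2 hf.1]
        refine mul_le_mul_right (setLIntegral_mono' measurableSet_Ioi fun u (hu : 0 < u) => ?_) _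
        exact rpow_mul_sum_enorm_coeff_sq_le hρcard hnorm he hp.le hf S hu
    _ ≤ ENNReal.ofReal (2 - p) * (2 * ENNReal.ofReal ((p - 1)⁻¹ + (2 - p)⁻¹)) :=
        mul_le_mul_right (mul_le_of_le_one_right' hnorm) _
    _ = ENNReal.ofReal (2 / (p - 1)) := by
        rw [← ENNReal.ofReal_ofNat 2, ← ENNReal.ofReal_mul (by positivity),
          ← ENNReal.ofReal_mul h2p.le]
        congr 1
        field_simp
        ring

end Normalized

lemma sum_enorm_mul_coeff_sq_le_of_lintegral_le_one (he : BoundedOrthonormal e)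
    (hp : 1 < p) (hp2 : p < 2) {c : ι → 𝕜} {N : ℝ} (hN : 0 < N)
    (hc : weakQuasinorm c (1 / p - 1 / 2) ≤ ENNReal.ofReal N)
    (hf : Integrable f μ) (hnorm : ∫⁻ x, ‖f x‖ₑ ^ p ∂μ ≤ 1) (S : Finset ι) :
    ∑ i ∈ S, ‖c i * coeff e f i‖ₑ ^ 2 ≤ ENNReal.ofReal (2 / (p - 1)) * ENNReal.ofReal N ^ 2 := by
  have h2p : 0 < 2 - p := by linarith
  have ha : 0 < 1 / p - 1 / 2 := sub_pos.2 (one_div_lt_one_div_of_lt (by linarith) hp2)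
  set ρ : ι → ℝ := fun i => (‖c i‖ / N) ^ (2 / (2 - p)) with hρdef
  have hρ (i : ι) : 0 ≤ ρ i := by positivity
  have hρcard (u : ℝ) (hu : 0 < u) :
      (({i | u ≤ ρ i}.encard : ℕ∞) : ℝ≥0∞) ≤ ENNReal.ofReal (u ^ (-p)) := by
    have hset : {i | u ≤ ρ i} = {i | N * u ^ ((2 - p) / 2) ≤ ‖c i‖} := by
      ext i
      rw [Set.mem_ofPred_eq, Set.mem_ofPred_eq, ← le_div_iff₀' hN, ← inv_div 2 (2 - p),
        Real.rpow_inv_le_iff_of_pos hu.le (by positivity) (by positivity)]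
    rw [hset]
    refine (encard_le_rpow_of_weakQuasinorm_le ha hN (by positivity) hc).trans_eq ?_
    rw [← Real.rpow_mul hu.le]
    congr 2
    field_simp
  have hweight (i : ι) :
      ‖c i * coeff e f i‖ₑ ^ 2 = ENNReal.ofReal N ^ 2 *
        (‖coeff e f i‖ₑ ^ 2 * ENNReal.ofReal (ρ i ^ (2 - p))) := by
    have hρpow : N ^ 2 * ρ i ^ (2 - p) = ‖c i‖ ^ 2 := by
      rw [hρdef, ← Real.rpow_mul (by positivity), div_mul_cancel₀ _ h2p.ne', Real.rpow_two, div_pow,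
        mul_div_cancel₀ _ (by positivity)]
    rw [enorm_mul, mul_pow, mul_left_comm, ← ENNReal.ofReal_pow hN.le,
      ← ENNReal.ofReal_mul (by positivity), hρpow, ENNReal.ofReal_pow (norm_nonneg _), ofReal_norm,
      mul_comm]
  simp only [hweight, ← Finset.mul_sum]
  rw [mul_comm]
  gcongr
  exact sum_enorm_coeff_sq_mul_rpow_le hρcard hnorm he hp hp2 hf hρ S

lemma sum_enorm_mul_coeff_sq_le_of_enorm_le (he : BoundedOrthonormal e) {c : ι → 𝕜} {M : ℝ≥0∞}
    (hc : ∀ i, ‖c i‖ₑ ≤ M) (hf : MemLp f 2 μ) (S : Finset ι) :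
    ∑ i ∈ S, ‖c i * coeff e f i‖ₑ ^ 2 ≤ (M * eLpNorm f 2 μ) ^ 2 := by
  calc ∑ i ∈ S, ‖c i * coeff e f i‖ₑ ^ 2
    _ ≤ ∑ i ∈ S, M ^ 2 * ‖coeff e f i‖ₑ ^ 2 := by
        simp only [enorm_mul, mul_pow]
        gcongr with i
        exact hc i
    _ ≤ (M * eLpNorm f 2 μ) ^ 2 := by
        rw [← Finset.mul_sum, mul_pow, eLpNorm_two_sq]
        gcongr
        exact he.sum_enorm_coeff_sq_le hf S

lemma sum_enorm_mul_coeff_sq_le_of_lt_two [IsFiniteMeasure μ] (he : BoundedOrthonormal e)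
    (hp : 1 < p) (hp2 : p < 2) {c : ι → 𝕜} {N : ℝ} (hN : 0 < N)
    (hc : weakQuasinorm c (1 / p - 1 / 2) ≤ ENNReal.ofReal N)
    (hf : MemLp f (ENNReal.ofReal p) μ) (S : Finset ι) :
    ∑ i ∈ S, ‖c i * coeff e f i‖ₑ ^ 2 ≤ ENNReal.ofReal (2 / (p - 1)) *
      (ENNReal.ofReal N * eLpNorm f (ENNReal.ofReal p) μ) ^ 2 := by
  have hp0 : 0 < p := by linarith
  set F := eLpNorm f (ENNReal.ofReal p) μ with hF
  rcases eq_or_ne F 0 with hF0 | hF0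
  · have hf0 : f =ᵐ[μ] 0 := (eLpNorm_eq_zero_iff hf.1 (by simpa using hp0)).1 hF0
    have hcoeff (i : ι) : coeff e f i = 0 := by
      rw [coeff_congr_ae hf0]
      simp [coeff]
    simp [hcoeff]
  have hFreal : 0 < F.toReal := ENNReal.toReal_pos hF0 hf.2.ne
  have henorm : ‖(F.toReal : 𝕜)‖ₑ = F := by
    rw [← ofReal_norm, RCLike.norm_ofReal, abs_of_pos hFreal, ENNReal.ofReal_toReal hf.2.ne]
  have hne : (F.toReal : 𝕜) ≠ 0 := RCLike.ofReal_ne_zero.2 hFreal.ne'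
  set g : X → 𝕜 := (F.toReal : 𝕜)⁻¹ • f with hg
  have hfg : f = (F.toReal : 𝕜) • g := (smul_inv_smul₀ hne f).symm
  have hgnorm : ∫⁻ x, ‖g x‖ₑ ^ p ∂μ ≤ 1 := by
    rw [← eLpNorm_ofReal_rpow hp0, hg, eLpNorm_const_smul, enorm_inv hne, henorm, ← hF,
      ENNReal.inv_mul_cancel hF0 hf.2.ne, ENNReal.one_rpow]
  have hgint : Integrable g μ := (hf.integrable (by simpa using hp.le)).smul _
  calc ∑ i ∈ S, ‖c i * coeff e f i‖ₑ ^ 2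
    _ = F ^ 2 * ∑ i ∈ S, ‖c i * coeff e g i‖ₑ ^ 2 := by
        rw [Finset.mul_sum]
        refine Finset.sum_congr rfl fun i _ => ?_
        rw [hfg, coeff_smul, mul_left_comm, enorm_mul, henorm, mul_pow]
    _ ≤ F ^ 2 * (ENNReal.ofReal (2 / (p - 1)) * ENNReal.ofReal N ^ 2) := by
        gcongr
        exact he.sum_enorm_mul_coeff_sq_le_of_lintegral_le_one hp hp2 hN hc hgint hgnorm S
    _ = ENNReal.ofReal (2 / (p - 1)) * (ENNReal.ofReal N * F) ^ 2 := by ring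

theorem sum_enorm_mul_coeff_sq_le [IsFiniteMeasure μ] (he : BoundedOrthonormal e) (hp : 1 < p)
    (hp2 : p ≤ 2) {c : ι → 𝕜} (hc : weakQuasinorm c (1 / p - 1 / 2) ≠ ⊤)
    (hf : MemLp f (ENNReal.ofReal p) μ) (S : Finset ι) :
    ∑ i ∈ S, ‖c i * coeff e f i‖ₑ ^ 2 ≤
      (ENNReal.ofReal √(2 / (p - 1)) * weakQuasinorm c (1 / p - 1 / 2) *
        eLpNorm f (ENNReal.ofReal p) μ) ^ 2 := by
  have ha : 0 ≤ 1 / p - 1 / 2 := sub_nonneg.2 (one_div_le_one_div_of_le (by linarith) hp2)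
  have hcM : ∀ i, ‖c i‖ₑ ≤ weakQuasinorm c (1 / p - 1 / 2) := enorm_le_weakQuasinorm ha
  rw [mul_assoc, mul_pow, ← ENNReal.ofReal_pow (Real.sqrt_nonneg _),
    Real.sq_sqrt (div_nonneg zero_le_two (by linarith))]
  rcases hp2.eq_or_lt with rfl | hp2
  · rw [ENNReal.ofReal_ofNat] at hf ⊢
    exact (he.sum_enorm_mul_coeff_sq_le_of_enorm_le hcM hf S).trans
      (le_mul_of_one_le_left' (by norm_num))
  rcases eq_or_ne (weakQuasinorm c (1 / p - 1 / 2)) 0 with hM0 | hM0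
  · have hzero (i : ι) : ‖c i‖ₑ = 0 := le_zero_iff.1 (hM0 ▸ hcM i)
    simp [enorm_mul, hzero]
  · have h := he.sum_enorm_mul_coeff_sq_le_of_lt_two hp hp2 (ENNReal.toReal_pos hM0 hc)
      (ENNReal.ofReal_toReal hc).ge hf S
    rwa [ENNReal.ofReal_toReal hc] at h

end BoundedOrthonormal

section ConverseHolder

variable {𝕜 X E : Type*} [RCLike 𝕜] [NormedAddCommGroup E] [InnerProductSpace 𝕜 E] {q q' : ℝ}
  {h : X → E}

/-- The function that attains equality in Hölder's inequality against `h`, cut off to `B`. -/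
def holderExtremizer (𝕜 : Type*) [RCLike 𝕜] [InnerProductSpace 𝕜 E] (q : ℝ) (h : X → E)
    (B : Set X) : X → E :=
  B.indicator fun x => ((‖h x‖ ^ (q - 2) : ℝ) : 𝕜) • h x

lemma norm_holderExtremizer (hq : 1 < q) (B : Set X) (x : X) :
    ‖holderExtremizer 𝕜 q h B x‖ = B.indicator (fun x => ‖h x‖ ^ (q - 1)) x := by
  rw [holderExtremizer, norm_indicator_eq_indicator_norm]
  congr 1
  ext x
  rw [norm_smul, RCLike.norm_ofReal, abs_of_nonneg (by positivity)]
  rcases eq_or_ne (h x) 0 with h0 | h0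
  · simp [h0, Real.zero_rpow (sub_pos.2 hq).ne']
  · rw [← Real.rpow_add_one (norm_ne_zero_iff.2 h0)]
    ring_nf

lemma inner_holderExtremizer (hq : 1 < q) (B : Set X) (x : X) :
    inner 𝕜 (h x) (holderExtremizer 𝕜 q h B x) =
      ((B.indicator (fun x => ‖h x‖ ^ q) x : ℝ) : 𝕜) := by
  by_cases hx : x ∈ B
  · rw [holderExtremizer, Set.indicator_of_mem hx, Set.indicator_of_mem hx, inner_smul_right,
      inner_self_eq_norm_sq_to_K]
    rcases eq_or_ne (h x) 0 with h0 | h0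
    · simp [h0, Real.zero_rpow (by linarith : q ≠ 0)]
    · norm_cast
      rw [← Real.rpow_two, ← Real.rpow_add (norm_pos_iff.2 h0), sub_add_cancel]
  · simp [holderExtremizer, hx]

variable [MeasurableSpace X] {μ : Measure X}

lemma memLp_holderExtremizer [IsFiniteMeasure μ] (hq : 1 < q) (hh : AEStronglyMeasurable h μ)
    {B : Set X} (hB : NullMeasurableSet B μ) {R : ℝ} (hR : ∀ x ∈ B, ‖h x‖ ≤ R) (p : ℝ≥0∞) :
    MemLp (holderExtremizer 𝕜 q h B) p μ := by
  have hmeas : AEStronglyMeasurable (holderExtremizer 𝕜 q h B) μ :=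
    AEStronglyMeasurable.indicator₀ (AEStronglyMeasurable.smul
      (RCLike.continuous_ofReal.comp_aestronglyMeasurable
        (hh.norm.aemeasurable.pow_const _).aestronglyMeasurable) hh) hB
  refine MemLp.of_bound hmeas (|R| ^ (q - 1)) (ae_of_all _ fun x => ?_)
  rw [norm_holderExtremizer hq]
  by_cases hx : x ∈ B
  · rw [Set.indicator_of_mem hx]
    exact Real.rpow_le_rpow (norm_nonneg _) ((hR x hx).trans (le_abs_self R)) (by linarith)
  · rw [Set.indicator_of_notMem hx]
    positivity

lemma eLpNorm_holderExtremizer (hqq' : q.HolderConjugate q') {B : Set X}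
    (hB : NullMeasurableSet B μ) :
    eLpNorm (holderExtremizer 𝕜 q h B) (ENNReal.ofReal q') μ =
      (∫⁻ x in B, ‖h x‖ₑ ^ q ∂μ) ^ q'⁻¹ := by
  have hexp : (q - 1) * q' = q := by rw [sub_mul, one_mul, hqq'.mul_eq_add, add_sub_cancel_right]
  rw [← (ENNReal.rpow_left_injective hqq'.symm.ne_zero).eq_iff,
    ENNReal.rpow_inv_rpow hqq'.symm.ne_zero, eLpNorm_ofReal_rpow hqq'.symm.pos,
    ← lintegral_indicator₀ hB]
  refine lintegral_congr fun x => ?_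
  rw [← ofReal_norm, norm_holderExtremizer hqq'.lt]
  by_cases hx : x ∈ B
  · rw [Set.indicator_of_mem hx, Set.indicator_of_mem hx,
      ← ENNReal.ofReal_rpow_of_nonneg (norm_nonneg _) hqq'.sub_one_pos.le, ofReal_norm,
      ← ENNReal.rpow_mul, hexp]
  · simp [hx, hqq'.symm.pos]

lemma integrableOn_norm_rpow_of_norm_le [IsFiniteMeasure μ] (hq : 0 ≤ q)
    (hh : AEStronglyMeasurable h μ) {B : Set X} (hB : NullMeasurableSet B μ) {R : ℝ}
    (hR : ∀ x ∈ B, ‖h x‖ ≤ R) : IntegrableOn (fun x => ‖h x‖ ^ q) B μ := by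
  refine Measure.integrableOn_of_bounded (M := R ^ q) (measure_ne_top μ B)
    (hh.norm.aemeasurable.pow_const q).aestronglyMeasurable ?_
  filter_upwards [ae_restrict_mem₀ hB] with x hx
  rw [Real.norm_of_nonneg (by positivity)]
  exact Real.rpow_le_rpow (norm_nonneg _) (hR x hx) hq

lemma enorm_integral_inner_holderExtremizer (hq : 1 < q) {B : Set X}
    (hB : NullMeasurableSet B μ) (hint : IntegrableOn (fun x => ‖h x‖ ^ q) B μ) :
    ‖∫ x, inner 𝕜 (h x) (holderExtremizer 𝕜 q h B x) ∂μ‖ₑ = ∫⁻ x in B, ‖h x‖ₑ ^ q ∂μ := by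
  have hnonneg (x : X) : 0 ≤ ‖h x‖ ^ q := by positivity
  simp only [inner_holderExtremizer hq]
  rw [integral_ofReal, integral_indicator₀ hB, ← ofReal_norm, RCLike.norm_ofReal,
    abs_of_nonneg (integral_nonneg hnonneg),
    ofReal_integral_eq_lintegral_ofReal hint (ae_of_all _ hnonneg)]
  refine lintegral_congr fun x => ?_
  rw [← ENNReal.ofReal_rpow_of_nonneg (norm_nonneg _) (by linarith), ofReal_norm]

variable [IsFiniteMeasure μ] {K : ℝ≥0∞}

lemma setLIntegral_enorm_rpow_le_of_forall_enorm_integral_inner_le (hqq' : q.HolderConjugate q')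
    (hh : AEStronglyMeasurable h μ)
    (hK : ∀ g : X → E, MemLp g ∞ μ →
      ‖∫ x, inner 𝕜 (h x) (g x) ∂μ‖ₑ ≤ K * eLpNorm g (ENNReal.ofReal q') μ)
    {B : Set X} (hB : NullMeasurableSet B μ) {R : ℝ} (hR : ∀ x ∈ B, ‖h x‖ ≤ R) :
    ∫⁻ x in B, ‖h x‖ₑ ^ q ∂μ ≤ K ^ q := by
  have hint := integrableOn_norm_rpow_of_norm_le hqq'.nonneg hh hB hR
  set I := ∫⁻ x in B, ‖h x‖ₑ ^ q ∂μ
  have hpairing := enorm_integral_inner_holderExtremizer (𝕜 := 𝕜) hqq'.lt hB hint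
  have hle : I ≤ K * I ^ q'⁻¹ := by
    have h := hK _ (memLp_holderExtremizer (𝕜 := 𝕜) hqq'.lt hh hB hR ∞)
    rwa [hpairing, eLpNorm_holderExtremizer hqq' hB] at h
  rcases eq_or_ne I 0 with hI0 | hI0
  · simp [hI0]
  have hItop : I ≠ ⊤ := by
    have h := (hasFiniteIntegral_iff_ofReal (ae_of_all _ fun x => by positivity)).1 hint.2
    simpa only [← ENNReal.ofReal_rpow_of_nonneg (norm_nonneg _) hqq'.nonneg, ofReal_norm]
      using h.ne
  rw [← ENNReal.rpow_inv_le_iff hqq'.pos, ← ENNReal.mul_le_mul_iff_left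
    (ENNReal.rpow_pos (pos_iff_ne_zero.2 hI0) hItop).ne'
    (ENNReal.rpow_ne_top_of_nonneg (inv_nonneg.2 hqq'.symm.nonneg) hItop),
    ← ENNReal.rpow_add _ _ hI0 hItop, hqq'.inv_add_inv_eq_one, ENNReal.rpow_one]
  exact hle

theorem eLpNorm_le_of_forall_enorm_integral_inner_le (hqq' : q.HolderConjugate q')
    (hh : AEStronglyMeasurable h μ)
    (hK : ∀ g : X → E, MemLp g ∞ μ →
      ‖∫ x, inner 𝕜 (h x) (g x) ∂μ‖ₑ ≤ K * eLpNorm g (ENNReal.ofReal q') μ) :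
    eLpNorm h (ENNReal.ofReal q) μ ≤ K := by
  let B : ℕ → Set X := fun n => {x | ‖h x‖ ≤ n}
  have hB (n : ℕ) : NullMeasurableSet (B n) μ :=
    nullMeasurableSet_le hh.norm.aemeasurable aemeasurable_const
  have hunion : ⋃ n, B n = Set.univ := Set.iUnion_eq_univ_iff.2 fun x => exists_nat_ge ‖h x‖
  have hmono : Monotone B := fun m n hmn x (hx : ‖h x‖ ≤ m) => hx.trans (Nat.cast_le.2 hmn)
  rw [← ENNReal.rpow_le_rpow_iff hqq'.pos, eLpNorm_ofReal_rpow hqq'.pos, ← setLIntegral_univ,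
    ← hunion, setLIntegral_iUnion_of_directed _ hmono.directed_le]
  exact iSup_le fun n => setLIntegral_enorm_rpow_le_of_forall_enorm_integral_inner_le hqq' hh hK
    (hB n) fun x hx => hx

end ConverseHolder

lemma weakQuasinorm_star {ι E : Type*} [NormedAddCommGroup E] [StarAddMonoid E]
    [NormedStarGroup E] (c : ι → E) (a : ℝ) : weakQuasinorm (star c) a = weakQuasinorm c a := by
  simp only [weakQuasinorm, Pi.star_apply, norm_star]

lemma holderConjugate_le_two {q q' : ℝ} (hqq' : q.HolderConjugate q') (hq : 2 ≤ q) : q' ≤ 2 := by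
  linarith [hqq'.mul_eq_add, mul_le_mul_of_nonneg_right hq hqq'.symm.sub_one_pos.le]

section Sequences

variable {ι E : Type*} [NormedAddCommGroup E] {K : ℝ≥0∞}

lemma sum_norm_rpow_two_le_of_sum_enorm_sq_le {a : ι → E} {S : Finset ι} (hK : K ≠ ⊤)
    (h : ∑ i ∈ S, ‖a i‖ₑ ^ 2 ≤ K ^ 2) :
    ∑ i ∈ S, ‖a i‖ ^ (2 : ℝ≥0∞).toReal ≤ K.toReal ^ (2 : ℝ≥0∞).toReal := by
  simp only [ENNReal.toReal_ofNat, Real.rpow_ofNat]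
  rw [← ENNReal.toReal_pow, ← ENNReal.ofReal_le_iff_le_toReal (ENNReal.pow_ne_top hK),
    ENNReal.ofReal_sum_of_nonneg fun i _ => by positivity]
  simpa only [ENNReal.ofReal_pow (norm_nonneg _), ofReal_norm] using h

lemma memℓp_two_of_sum_enorm_sq_le {a : ι → E} (hK : K ≠ ⊤)
    (h : ∀ S : Finset ι, ∑ i ∈ S, ‖a i‖ₑ ^ 2 ≤ K ^ 2) : Memℓp a 2 :=
  memℓp_gen' fun S => sum_norm_rpow_two_le_of_sum_enorm_sq_le hK (h S)

lemma enorm_lp_two_le_of_sum_enorm_sq_le (a : lp (fun _ : ι => E) 2)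
    (h : ∀ S : Finset ι, ∑ i ∈ S, ‖a i‖ₑ ^ 2 ≤ K ^ 2) : ‖a‖ₑ ≤ K := by
  rcases eq_or_ne K ⊤ with rfl | hK
  · exact le_top
  rw [← ofReal_norm, ENNReal.ofReal_le_iff_le_toReal hK]
  exact lp.norm_le_of_forall_sum_le (by norm_num) ENNReal.toReal_nonneg fun S =>
    sum_norm_rpow_two_le_of_sum_enorm_sq_le hK (h S)

end Sequences

section Synthesis

variable {𝕜 ι E : Type*} [RCLike 𝕜] [NormedAddCommGroup E] [InnerProductSpace 𝕜 E]
  [CompleteSpace E] {v : ι → E}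

/-- The isometry `a ↦ ∑ i, a i • v i` from `ℓ²` defined by an orthonormal family, which need not
be complete. -/
def synthesis (hv : Orthonormal 𝕜 v) : lp (fun _ : ι => 𝕜) 2 →ₗᵢ[𝕜] E :=
  hv.orthogonalFamily.linearIsometry

lemma hasSum_inner_synthesis (hv : Orthonormal 𝕜 v) (a : lp (fun _ : ι => 𝕜) 2) (y : E) :
    HasSum (fun i => inner 𝕜 (a i) (inner 𝕜 (v i) y)) (inner 𝕜 (synthesis hv a) y) := by
  have h : HasSum (fun i => inner 𝕜 (a i • v i) y) (inner 𝕜 (synthesis hv a) y) :=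
    ((innerSL 𝕜).flip y).hasSum (hv.orthogonalFamily.hasSum_linearIsometry a)
  exact h.congr_fun fun i => by rw [inner_smul_left, RCLike.inner_apply, mul_comm]

lemma inner_synthesis (hv : Orthonormal 𝕜 v) (a : lp (fun _ : ι => 𝕜) 2) (i : ι) :
    inner 𝕜 (v i) (synthesis hv a) = a i := by
  classical
  have hsingle : synthesis hv (lp.single 2 i 1) = v i := by
    simp [synthesis, OrthogonalFamily.linearIsometry_apply_single]
  rw [← hsingle, LinearIsometry.inner_map_map, lp.inner_single_left]
  simp

lemma synthesis_eq_of_mem_closure_span (hv : Orthonormal 𝕜 v) {a : lp (fun _ : ι => 𝕜) 2} {y : E}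
    (hy : y ∈ (Submodule.span 𝕜 (Set.range v)).topologicalClosure)
    (hcoeff : ∀ i, inner 𝕜 (v i) y = a i) : synthesis hv a = y := by
  have hspan : Submodule.span 𝕜 (Set.range v) =
      ⨆ i, (LinearIsometry.toSpanSingleton 𝕜 E (hv.1 i)).toLinearMap.range := by
    simp only [Submodule.span_range_eq_iSup, LinearMap.span_singleton_eq_range]
    rfl
  rw [hspan, ← OrthogonalFamily.range_linearIsometry hv.orthogonalFamily] at hy
  obtain ⟨b, rfl⟩ := hy
  have hab : a = b := lp.ext <| funext fun i => (hcoeff i).symm.trans (inner_synthesis hv b i)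
  rw [hab]
  rfl

end Synthesis

/-- A linear map into `Lᵖ` whose values all lie in `Lʳ`, as a linear map into `Lʳ`. -/
def lpCodRestrict {𝕜 X V E : Type*} [NormedRing 𝕜] [MeasurableSpace X] {μ : Measure X}
    [NormedAddCommGroup E] [Module 𝕜 E] [IsBoundedSMul 𝕜 E] [AddCommGroup V] [Module 𝕜 V]
    {p r : ℝ≥0∞} (T : V →ₗ[𝕜] Lp E p μ) (hT : ∀ v, MemLp (T v) r μ) : V →ₗ[𝕜] Lp E r μ where
  toFun v := (hT v).toLp
  map_add' v w := by
    rw [← MemLp.toLp_add, MemLp.toLp_eq_toLp_iff, map_add]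
    exact Lp.coeFn_add _ _
  map_smul' c v := by
    rw [RingHom.id_apply, ← MemLp.toLp_const_smul, MemLp.toLp_eq_toLp_iff, map_smul]
    exact Lp.coeFn_smul _ _

section Multiplier

variable {𝕜 X ι : Type*} [RCLike 𝕜] [MeasurableSpace X] {μ : Measure X} {e : ι → Lp 𝕜 2 μ}
  {σ : ι → 𝕜} {p q q' : ℝ}

namespace BoundedOrthonormal

lemma memℓp_mul_coeff_of_enorm_le (he : BoundedOrthonormal e) {M : ℝ≥0∞} (hM : M ≠ ⊤)
    (hσ : ∀ i, ‖σ i‖ₑ ≤ M) {f : X → 𝕜} (hf : MemLp f 2 μ) :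
    Memℓp (fun i => σ i * coeff e f i) 2 :=
  memℓp_two_of_sum_enorm_sq_le (ENNReal.mul_ne_top hM hf.2.ne)
    (he.sum_enorm_mul_coeff_sq_le_of_enorm_le hσ hf)

section FiniteMeasure

variable [IsFiniteMeasure μ]

lemma memℓp_mul_coeff_of_le_two (he : BoundedOrthonormal e) (hp : 1 < p) (hp2 : p ≤ 2)
    (hσ : weakQuasinorm σ (1 / p - 1 / 2) ≠ ⊤) {f : X → 𝕜} (hf : MemLp f (ENNReal.ofReal p) μ) :
    Memℓp (fun i => σ i * coeff e f i) 2 :=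
  memℓp_two_of_sum_enorm_sq_le
    (ENNReal.mul_ne_top (ENNReal.mul_ne_top ENNReal.ofReal_ne_top hσ) hf.2.ne)
    (he.sum_enorm_mul_coeff_sq_le hp hp2 hσ hf)

/-- The multiplier operator with symbol `σ`, from `Lᵖ` to `L²`, given that it maps `Lᵖ` to
square-summable coefficients. -/
def multiplier (he : BoundedOrthonormal e) {p : ℝ≥0∞} (hp : 1 ≤ p) (σ : ι → 𝕜)
    (hσ : ∀ u : Lp 𝕜 p μ, Memℓp (fun i => σ i * coeff e u i) 2) : Lp 𝕜 p μ →ₗ[𝕜] Lp 𝕜 2 μ where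
  toFun u := synthesis he.orthonormal ⟨_, hσ u⟩
  map_add' u v := by
    rw [← map_add]
    congr 1
    ext i
    have hu := (Lp.memLp u).integrable hp
    have hv := (Lp.memLp v).integrable hp
    simp only [coeff_congr_ae (Lp.coeFn_add u v), he.coeff_add hu hv, mul_add]
    rfl
  map_smul' c u := by
    rw [RingHom.id_apply, ← map_smul]
    congr 1
    ext i
    simp only [coeff_congr_ae (Lp.coeFn_smul c u), coeff_smul, mul_left_comm]
    rfl

lemma multiplier_eq_of_mem_closure_span (he : BoundedOrthonormal e) {p : ℝ≥0∞} (hp : 1 ≤ p)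
    (hσ : ∀ u : Lp 𝕜 p μ, Memℓp (fun i => σ i * coeff e u i) 2) {u : Lp 𝕜 p μ} {y : Lp 𝕜 2 μ}
    (hy : y ∈ (Submodule.span 𝕜 (Set.range e)).topologicalClosure)
    (hcoeff : ∀ i, inner 𝕜 (e i) y = σ i * coeff e u i) : he.multiplier hp σ hσ u = y :=
  synthesis_eq_of_mem_closure_span he.orthonormal hy hcoeff

lemma eLpNorm_two_multiplier_le (he : BoundedOrthonormal e) {p : ℝ≥0∞} (hp : 1 ≤ p)
    (hσ : ∀ u : Lp 𝕜 p μ, Memℓp (fun i => σ i * coeff e u i) 2) {u : Lp 𝕜 p μ} {K : ℝ≥0∞}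
    (hK : ∀ S : Finset ι, ∑ i ∈ S, ‖σ i * coeff e u i‖ₑ ^ 2 ≤ K ^ 2) :
    eLpNorm (he.multiplier hp σ hσ u) 2 μ ≤ K := by
  rw [← Lp.enorm_def]
  refine ((synthesis he.orthonormal).enorm_map _).trans_le ?_
  exact enorm_lp_two_le_of_sum_enorm_sq_le _ hK

lemma integral_inner_multiplier_eq (he : BoundedOrthonormal e) {p : ℝ≥0∞} (hp : 1 ≤ p)
    (hσ : ∀ u : Lp 𝕜 p μ, Memℓp (fun i => σ i * coeff e u i) 2) {u : Lp 𝕜 p μ} {g : X → 𝕜}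
    (hg : MemLp g 2 μ) {a b : lp (fun _ : ι => 𝕜) 2} (ha : ∀ i, a i = coeff e u i)
    (hb : ∀ i, b i = star (σ i) * coeff e g i) :
    ∫ x, inner 𝕜 (he.multiplier hp σ hσ u x) (g x) ∂μ = inner 𝕜 a b := by
  have hL2 : ∫ x, inner 𝕜 (he.multiplier hp σ hσ u x) (g x) ∂μ =
      inner 𝕜 (he.multiplier hp σ hσ u) (hg.toLp g) := by
    rw [L2.inner_def]
    exact integral_congr_ae (hg.coeFn_toLp.mono fun x hx => by simp only [hx])
  have hT := hasSum_inner_synthesis he.orthonormal ⟨_, hσ u⟩ (hg.toLp g)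
  rw [hL2]
  refine hT.unique ((lp.hasSum_inner a b).congr_fun fun i => ?_)
  rw [ha, hb, coeff_eq_inner hg]
  simp only [RCLike.inner_apply, map_mul, RCLike.star_def]
  ring

lemma eLpNorm_multiplier_le_of_two_le (he : BoundedOrthonormal e) (hqq' : q.HolderConjugate q')
    (hq : 2 ≤ q) (hσ : weakQuasinorm σ (1 / q' - 1 / 2) ≠ ⊤) {p : ℝ≥0∞} (hp : 1 ≤ p)
    (hmem : ∀ u : Lp 𝕜 p μ, Memℓp (fun i => σ i * coeff e u i) 2) {u : Lp 𝕜 p μ}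
    (hu : MemLp u 2 μ) :
    eLpNorm (he.multiplier hp σ hmem u) (ENNReal.ofReal q) μ ≤
      ENNReal.ofReal √(2 / (q' - 1)) * weakQuasinorm σ (1 / q' - 1 / 2) * eLpNorm u 2 μ := by
  have hq'2 : q' ≤ 2 := holderConjugate_le_two hqq' hq
  refine eLpNorm_le_of_forall_enorm_integral_inner_le (𝕜 := 𝕜) hqq' (Lp.aestronglyMeasurable _)
    fun g hg => ?_
  have hg' : MemLp g (ENNReal.ofReal q') μ := hg.mono_exponent le_top
  have hσ' : weakQuasinorm (star σ) (1 / q' - 1 / 2) ≠ ⊤ := by rwa [weakQuasinorm_star]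
  have hu_le (S : Finset ι) : ∑ i ∈ S, ‖coeff e u i‖ₑ ^ 2 ≤ eLpNorm u 2 μ ^ 2 :=
    (he.sum_enorm_coeff_sq_le hu S).trans_eq (eLpNorm_two_sq _).symm
  let a : lp (fun _ : ι => 𝕜) 2 := ⟨coeff e u, memℓp_two_of_sum_enorm_sq_le hu.2.ne hu_le⟩
  let b : lp (fun _ : ι => 𝕜) 2 :=
    ⟨_, he.memℓp_mul_coeff_of_le_two hqq'.symm.lt hq'2 hσ' hg'⟩
  calc ‖∫ x, inner 𝕜 (he.multiplier hp σ hmem u x) (g x) ∂μ‖ₑ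
    _ = ‖(inner 𝕜 a b : 𝕜)‖ₑ := by
        rw [he.integral_inner_multiplier_eq hp hmem (hg.mono_exponent le_top) (a := a) (b := b)
          (fun _ => rfl) fun _ => rfl]
    _ ≤ ‖a‖ₑ * ‖b‖ₑ := by
        simpa only [enorm_eq_nnnorm, ← ENNReal.coe_mul, ENNReal.coe_le_coe] using
          nnnorm_inner_le_nnnorm a b
    _ ≤ eLpNorm u 2 μ * (ENNReal.ofReal √(2 / (q' - 1)) *
          weakQuasinorm (star σ) (1 / q' - 1 / 2) * eLpNorm g (ENNReal.ofReal q') μ) :=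
        mul_le_mul' (enorm_lp_two_le_of_sum_enorm_sq_le a hu_le)
          (enorm_lp_two_le_of_sum_enorm_sq_le b
            (he.sum_enorm_mul_coeff_sq_le hqq'.symm.lt hq'2 hσ' hg'))
    _ = ENNReal.ofReal √(2 / (q' - 1)) * weakQuasinorm σ (1 / q' - 1 / 2) * eLpNorm u 2 μ *
          eLpNorm g (ENNReal.ofReal q') μ := by
        rw [weakQuasinorm_star]
        ring

end FiniteMeasure

section ProbabilityMeasure

variable [IsProbabilityMeasure μ]

theorem eLpNorm_multiplier_le_of_exponents_le_two (he : BoundedOrthonormal e) (hp : 1 < p)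
    (hp2 : p ≤ 2) {r : ℝ≥0∞} (hr : r ≤ 2) (hσ : weakQuasinorm σ (1 / p - 1 / 2) ≠ ⊤)
    (hmem : ∀ u : Lp 𝕜 (ENNReal.ofReal p) μ, Memℓp (fun i => σ i * coeff e u i) 2)
    (u : Lp 𝕜 (ENNReal.ofReal p) μ) :
    eLpNorm (he.multiplier (ENNReal.one_le_ofReal.2 hp.le) σ hmem u) r μ ≤
      ENNReal.ofReal √(2 / (p - 1)) * weakQuasinorm σ (1 / p - 1 / 2) *
        eLpNorm u (ENNReal.ofReal p) μ :=
  (eLpNorm_le_eLpNorm_of_exponent_le hr (Lp.aestronglyMeasurable _)).trans <|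
    he.eLpNorm_two_multiplier_le _ hmem (he.sum_enorm_mul_coeff_sq_le hp hp2 hσ (Lp.memLp u))

theorem eLpNorm_multiplier_le_of_two_le_exponents (he : BoundedOrthonormal e)
    (hqq' : q.HolderConjugate q') (hq : 2 ≤ q) (hσ : weakQuasinorm σ (1 / q' - 1 / 2) ≠ ⊤)
    {r : ℝ≥0∞} (hr : 2 ≤ r)
    (hmem : ∀ u : Lp 𝕜 r μ, Memℓp (fun i => σ i * coeff e u i) 2) (u : Lp 𝕜 r μ) :
    eLpNorm (he.multiplier (one_le_two.trans hr) σ hmem u) (ENNReal.ofReal q) μ ≤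
      ENNReal.ofReal √(2 / (q' - 1)) * weakQuasinorm σ (1 / q' - 1 / 2) * eLpNorm u r μ :=
  (he.eLpNorm_multiplier_le_of_two_le hqq' hq hσ _ hmem ((Lp.memLp u).mono_exponent hr)).trans <|
    mul_le_mul_right (eLpNorm_le_eLpNorm_of_exponent_le hr (Lp.aestronglyMeasurable u)) _

end ProbabilityMeasure

end BoundedOrthonormal

end Multiplier

section PullbackLp

variable {X K : Type*} [MeasurableSpace X] [TopologicalSpace K] [CompactSpace K]
  [MeasurableSpace K] [BorelSpace K] {μ : Measure X} [IsFiniteMeasure μ] {τ : X → K}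

/-- The pullback `G ↦ G ∘ τ` of continuous functions on a compact space to `L²(μ)`. -/
def pullbackLp (μ : Measure X) [IsFiniteMeasure μ] (hτ : Measurable τ) :
    C(K, ℂ) →L[ℂ] Lp ℂ 2 μ :=
  (Lp.compMeasurePreservingₗᵢ ℂ τ ⟨hτ, rfl⟩).toContinuousLinearMap ∘L
    ContinuousMap.toLp 2 (μ.map τ) ℂ

lemma coeFn_pullbackLp (hτ : Measurable τ) (G : C(K, ℂ)) :
    pullbackLp μ hτ G =ᵐ[μ] G ∘ τ :=
  (Lp.coeFn_compMeasurePreserving _ ⟨hτ, rfl⟩).trans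
    (ae_of_ae_map hτ.aemeasurable (ContinuousMap.coeFn_toLp (𝕜 := ℂ) (μ.map τ) G))

end PullbackLp

section Lattice

variable {d : ℕ} {L : Submodule ℤ (EuclideanSpace ℝ (Fin d))} {Ω : Set (EuclideanSpace ℝ (Fin d))}
  {f : EuclideanSpace ℝ (Fin d) → ℂ}

section Volume

open scoped Pointwise

instance isFiniteMeasure_normVol (Ω : Set (EuclideanSpace ℝ (Fin d))) :
    IsFiniteMeasure (normVol Ω) :=
  ⟨by simpa [normVol] using (ENNReal.inv_mul_le_one (volume Ω)).trans_lt ENNReal.one_lt_top⟩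

lemma vaddInvariantMeasure_lattice (L : Submodule ℤ (EuclideanSpace ℝ (Fin d))) :
    VAddInvariantMeasure L (EuclideanSpace ℝ (Fin d)) volume :=
  ⟨fun l s _ => measure_preimage_add volume (l : EuclideanSpace ℝ (Fin d)) s⟩

lemma IsFundamentalDomain.isAddFundamentalDomain (hΩ : IsFundamentalDomain L Ω) :
    IsAddFundamentalDomain L Ω volume :=
  IsAddFundamentalDomain.mk' hΩ.measurable fun x => by
    simpa only [Submodule.vadd_def, vadd_eq_add, add_comm] using hΩ.existsUnique x

variable [DiscreteTopology L] [IsZLattice ℝ L]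

lemma IsFundamentalDomain.volume_ne_zero (hΩ : IsFundamentalDomain L Ω) : volume Ω ≠ 0 :=
  have := vaddInvariantMeasure_lattice L
  hΩ.isAddFundamentalDomain.measure_ne_zero (NeZero.ne volume)

lemma IsFundamentalDomain.volume_ne_top (hΩ : IsFundamentalDomain L Ω) : volume Ω ≠ ⊤ := by
  have := vaddInvariantMeasure_lattice L
  let b := Module.Free.chooseBasis ℤ L
  rw [hΩ.isAddFundamentalDomain.measure_eq (ZLattice.isAddFundamentalDomain b volume)]
  exact (ZSpan.fundamentalDomain_isBounded (b.ofZLatticeBasis ℝ)).measure_lt_top.ne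

lemma IsFundamentalDomain.isProbabilityMeasure (hΩ : IsFundamentalDomain L Ω) :
    IsProbabilityMeasure (normVol Ω) :=
  ⟨by simp [normVol, ENNReal.inv_mul_cancel hΩ.volume_ne_zero hΩ.volume_ne_top]⟩

lemma IsFundamentalDomain.integral_normVol_translate (hΩ : IsFundamentalDomain L Ω)
    (hf : ∀ x, ∀ l ∈ L, f (x + l) = f x) (y : EuclideanSpace ℝ (Fin d)) :
    ∫ x, f (y + x) ∂(normVol Ω) = ∫ x, f x ∂(normVol Ω) := by
  have := vaddInvariantMeasure_lattice L
  have hD := hΩ.isAddFundamentalDomain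
  have hshift : ∫ x in y +ᵥ Ω, f x = ∫ x in Ω, f x := by
    refine (hD.vadd_of_comm y).setIntegral_eq hD fun l x => ?_
    rw [Submodule.vadd_def, vadd_eq_add, add_comm]
    exact hf x l l.2
  simp only [normVol, integral_smul_measure]
  rw [← hshift]
  exact congrArg _ ((measurePreserving_vadd y volume).setIntegral_image_emb
    (measurableEmbedding_const_vadd y) f Ω).symm

end Volume

section Character

/-- The character `x ↦ e^{2πi κ·x}`. -/
def character (κ x : EuclideanSpace ℝ (Fin d)) : ℂ :=
  Complex.exp (2 * Real.pi * Complex.I * ((inner ℝ κ x : ℝ) : ℂ))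

lemma continuous_character (κ : EuclideanSpace ℝ (Fin d)) : Continuous (character κ) := by
  unfold character
  fun_prop

lemma norm_character (κ x : EuclideanSpace ℝ (Fin d)) : ‖character κ x‖ = 1 := by
  have h : 2 * Real.pi * Complex.I * ((inner ℝ κ x : ℝ) : ℂ) =
      ((2 * Real.pi * inner ℝ κ x : ℝ) : ℂ) * Complex.I := by push_cast; ring
  rw [character, h, Complex.norm_exp_ofReal_mul_I]

lemma star_character (κ x : EuclideanSpace ℝ (Fin d)) :
    starRingEnd ℂ (character κ x) =
      Complex.exp (-(2 * Real.pi * Complex.I * ((inner ℝ κ x : ℝ) : ℂ))) := by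
  simp [character, ← Complex.exp_conj, Complex.conj_ofNat]

lemma character_add_right (κ x y : EuclideanSpace ℝ (Fin d)) :
    character κ (x + y) = character κ x * character κ y := by
  simp only [character, ← Complex.exp_add, inner_add_right, Complex.ofReal_add, mul_add]

lemma character_sub_left (κ η x : EuclideanSpace ℝ (Fin d)) :
    character (κ - η) x = character κ x * starRingEnd ℂ (character η x) := by
  rw [star_character, character, character, ← Complex.exp_add, inner_sub_left, Complex.ofReal_sub,
    mul_sub, sub_eq_add_neg]

lemma character_of_mem {κ l : EuclideanSpace ℝ (Fin d)} (hκ : κ ∈ dualLattice L) (hl : l ∈ L) :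
    character κ l = 1 := by
  obtain ⟨n, hn⟩ := hκ l hl
  rw [character, hn, Complex.exp_eq_one_iff]
  exact ⟨n, by push_cast; ring⟩

lemma exists_character_ne_one {κ : EuclideanSpace ℝ (Fin d)} (hκ : κ ≠ 0) :
    ∃ y, character κ y ≠ 1 := by
  have hinner : (inner ℝ κ ((2 * ‖κ‖ ^ 2)⁻¹ • κ) : ℝ) = 1 / 2 := by
    have := norm_ne_zero_iff.2 hκ
    rw [inner_smul_right, real_inner_self_eq_norm_sq]
    field_simp
  have hexp : 2 * Real.pi * Complex.I * ((1 / 2 : ℝ) : ℂ) = Real.pi * Complex.I := by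
    push_cast; ring
  refine ⟨(2 * ‖κ‖ ^ 2)⁻¹ • κ, ?_⟩
  rw [character, hinner, hexp, Complex.exp_pi_mul_I]
  norm_num

lemma memLp_character (Ω : Set (EuclideanSpace ℝ (Fin d))) (κ : EuclideanSpace ℝ (Fin d)) :
    MemLp (character κ) 2 (normVol Ω) :=
  MemLp.of_bound (continuous_character κ).aestronglyMeasurable 1
    (Filter.Eventually.of_forall fun x => (norm_character κ x).le)

/-- The characters of the dual lattice as elements of `L²(Ω)`. -/
def characterLp (Ω : Set (EuclideanSpace ℝ (Fin d))) (κ : dualLattice L) : Lp ℂ 2 (normVol Ω) :=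
  (memLp_character Ω κ).toLp

lemma coeFn_characterLp (Ω : Set (EuclideanSpace ℝ (Fin d))) (κ : dualLattice L) :
    characterLp Ω κ =ᵐ[normVol Ω] character κ :=
  (memLp_character Ω κ).coeFn_toLp

lemma coeff_characterLp (f : EuclideanSpace ℝ (Fin d) → ℂ) (κ : dualLattice L) :
    coeff (characterLp Ω) f κ = fourierCoefficient Ω f κ := by
  refine integral_congr_ae ((coeFn_characterLp Ω κ).mono fun x hx => ?_)
  simp only [hx, RCLike.inner_apply, star_character]

lemma inner_characterLp (κ η : dualLattice L) :
    inner ℂ (characterLp Ω κ) (characterLp Ω η) =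
      ∫ x, character (η - κ : EuclideanSpace ℝ (Fin d)) x ∂(normVol Ω) := by
  rw [characterLp.eq_def Ω η, ← coeff_eq_inner, coeff_characterLp, fourierCoefficient]
  simp only [character_sub_left, star_character]

variable [DiscreteTopology L] [IsZLattice ℝ L]

lemma IsFundamentalDomain.integral_character_eq_zero (hΩ : IsFundamentalDomain L Ω)
    {κ : EuclideanSpace ℝ (Fin d)} (hκL : ∀ l ∈ L, character κ l = 1) (hκ : κ ≠ 0) :
    ∫ x, character κ x ∂(normVol Ω) = 0 := by
  obtain ⟨y, hy⟩ := exists_character_ne_one hκ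
  have hperiodic : ∀ x, ∀ l ∈ L, character κ (x + l) = character κ x := fun x l hl => by
    rw [character_add_right, hκL l hl, mul_one]
  have htranslate : character κ y * ∫ x, character κ x ∂(normVol Ω) =
      ∫ x, character κ x ∂(normVol Ω) := by
    simpa only [character_add_right, integral_const_mul] using
      hΩ.integral_normVol_translate hperiodic y
  by_contra hne
  exact hy (mul_eq_right₀ hne |>.1 htranslate)

lemma IsFundamentalDomain.orthonormal_characterLp (hΩ : IsFundamentalDomain L Ω) :
    Orthonormal ℂ (characterLp (L := L) Ω) := by
  classical
  have := hΩ.isProbabilityMeasure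
  refine orthonormal_iff_ite.2 fun κ η => ?_
  rw [inner_characterLp]
  split_ifs with h
  · simp [h, character]
  · refine hΩ.integral_character_eq_zero (fun l hl => ?_)
      (sub_ne_zero.2 fun hηκ => h (Subtype.ext hηκ.symm))
    rw [character_sub_left, character_of_mem η.2 hl, character_of_mem κ.2 hl, map_one, mul_one]

lemma IsFundamentalDomain.boundedOrthonormal_characterLp (hΩ : IsFundamentalDomain L Ω) :
    BoundedOrthonormal (characterLp (L := L) Ω) where
  orthonormal := hΩ.orthonormal_characterLp
  norm_le_one κ := by
    filter_upwards [coeFn_characterLp Ω κ] with x hx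
    rw [hx, norm_character]

end Character

section Density

variable {ι : Type*} [Fintype ι]

/-- The projection onto the torus in the coordinates of a basis. -/
def torusMap (B : Module.Basis ι ℝ (EuclideanSpace ℝ (Fin d))) :
    C(EuclideanSpace ℝ (Fin d), UnitAddTorus ι) where
  toFun x i := (B.equivFunL x i : ℝ)
  continuous_toFun := by fun_prop

lemma isQuotientMap_torusMap (B : Module.Basis ι ℝ (EuclideanSpace ℝ (Fin d))) :
    Topology.IsQuotientMap (torusMap B) :=
  have hmk : IsOpenQuotientMap (Pi.map fun _ : ι => ((↑) : ℝ → UnitAddCircle)) :=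
    IsOpenQuotientMap.piMap fun _ => QuotientAddGroup.isOpenQuotientMap_mk
  hmk.isQuotientMap.comp B.equivFunL.toHomeomorph.isQuotientMap

variable [DiscreteTopology L] [IsZLattice ℝ L]

lemma sub_mem_of_torusMap_eq (b : Module.Basis ι ℤ L) {x y : EuclideanSpace ℝ (Fin d)}
    (h : torusMap (b.ofZLatticeBasis ℝ) x = torusMap (b.ofZLatticeBasis ℝ) y) : x - y ∈ L := by
  set B := b.ofZLatticeBasis ℝ
  have hint (i : ι) : ∃ n : ℤ, B.equivFun (x - y) i = n := by
    obtain ⟨n, hn⟩ := AddSubgroup.mem_zmultiples_iff.1 (QuotientAddGroup.eq.1 (congrFun h.symm i))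
    refine ⟨n, ?_⟩
    rw [map_sub, Pi.sub_apply, sub_eq_neg_add]
    simpa using hn.symm
  choose n hn using hint
  rw [← B.sum_equivFun (x - y)]
  refine L.sum_mem fun i _ => ?_
  rw [hn i, Int.cast_smul_eq_zsmul, b.ofZLatticeBasis_apply ℝ L]
  exact L.smul_mem _ (b i).2

lemma exists_continuousMap_torus (b : Module.Basis ι ℤ L)
    (hf : Continuous f) (hper : ∀ x, ∀ l ∈ L, f (x + l) = f x) :
    ∃ G : C(UnitAddTorus ι, ℂ), G ∘ torusMap (b.ofZLatticeBasis ℝ) = f := by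
  have hfactors : Function.FactorsThrough f (torusMap (b.ofZLatticeBasis ℝ)) := fun x y hxy => by
    simpa only [add_sub_cancel] using hper y _ (sub_mem_of_torusMap_eq b hxy)
  have hquot := isQuotientMap_torusMap (b.ofZLatticeBasis ℝ)
  exact ⟨hquot.lift ⟨f, hf⟩ hfactors, congrArg DFunLike.coe (hquot.lift_comp ⟨f, hf⟩ hfactors)⟩

lemma exists_mem_dualLattice_inner_eq (b : Module.Basis ι ℤ L) (n : ι → ℤ) :
    ∃ κ ∈ dualLattice L, ∀ x, inner ℝ κ x = ∑ i, n i * (b.ofZLatticeBasis ℝ).repr x i := by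
  let ℓ : EuclideanSpace ℝ (Fin d) →ₗ[ℝ] ℝ := ∑ i, (n i : ℝ) • (b.ofZLatticeBasis ℝ).coord i
  have hinner (x) : inner ℝ ((InnerProductSpace.toDual ℝ (EuclideanSpace ℝ (Fin d))).symm
      (LinearMap.toContinuousLinearMap ℓ)) x = ∑ i, n i * (b.ofZLatticeBasis ℝ).repr x i := by
    rw [InnerProductSpace.toDual_symm_apply]
    simp [ℓ]
  refine ⟨_, fun l hl => ⟨∑ i, n i * b.repr ⟨l, hl⟩ i, ?_⟩, hinner⟩
  rw [hinner]
  push_cast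
  exact Finset.sum_congr rfl fun i _ =>
    congrArg _ (b.ofZLatticeBasis_repr_apply ℝ L ⟨l, hl⟩ i)

lemma exists_mFourier_comp_torusMap_eq_character (b : Module.Basis ι ℤ L) (n : ι → ℤ) :
    ∃ κ : dualLattice L,
      UnitAddTorus.mFourier n ∘ torusMap (b.ofZLatticeBasis ℝ) = character κ := by
  obtain ⟨κ, hκL, hκ⟩ := exists_mem_dualLattice_inner_eq b n
  refine ⟨⟨κ, hκL⟩, funext fun x => ?_⟩
  simp only [Function.comp_apply, UnitAddTorus.mFourier, ContinuousMap.coe_mk, torusMap,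
    fourier_coe_apply, character, ← Complex.exp_sum, hκ]
  push_cast
  rw [Finset.mul_sum]
  refine congrArg _ (Finset.sum_congr rfl fun i _ => ?_)
  simp only [Module.Basis.equivFunL_apply, div_one]
  ring

lemma memLp_of_continuous_periodic (hf : Continuous f) (hper : ∀ x, ∀ l ∈ L, f (x + l) = f x)
    (r : ℝ≥0∞) : MemLp f r (normVol Ω) := by
  obtain ⟨G, rfl⟩ := exists_continuousMap_torus (Module.Free.chooseBasis ℤ L) hf hper
  exact MemLp.of_bound hf.aestronglyMeasurable ‖G‖
    (Filter.Eventually.of_forall fun x => G.norm_coe_le_norm _)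

theorem toLp_mem_closure_span_characterLp (hf : Continuous f)
    (hper : ∀ x, ∀ l ∈ L, f (x + l) = f x) (hfL : MemLp f 2 (normVol Ω)) :
    hfL.toLp f ∈
      (Submodule.span ℂ (Set.range (characterLp (L := L) Ω))).topologicalClosure := by
  let b := Module.Free.chooseBasis ℤ L
  let τ := torusMap (b.ofZLatticeBasis ℝ)
  let Λ := pullbackLp (normVol Ω) τ.continuous.measurable
  obtain ⟨G, hG⟩ := exists_continuousMap_torus b hf hper
  have hΛG : Λ G = hfL.toLp f :=
    Lp.ext ((coeFn_pullbackLp _ G).trans (hG ▸ hfL.coeFn_toLp.symm))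
  have hspan : Submodule.span ℂ (Set.range UnitAddTorus.mFourier) ≤
      (Submodule.span ℂ (Set.range (characterLp (L := L) Ω))).comap Λ.toLinearMap := by
    rw [Submodule.span_le]
    rintro _ ⟨n, rfl⟩
    obtain ⟨κ, hκ⟩ := exists_mFourier_comp_torusMap_eq_character b n
    refine Submodule.subset_span ⟨κ, Lp.ext ?_⟩
    exact (coeFn_characterLp Ω κ).trans (hκ ▸ (coeFn_pullbackLp _ _).symm)
  have hdense : G ∈ (Submodule.span ℂ (Set.range UnitAddTorus.mFourier)).topologicalClosure := by
    rw [UnitAddTorus.span_mFourier_closure_eq_top]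
    trivial
  rw [← hΛG]
  exact map_mem_closure Λ.continuous hdense fun P hP => hspan hP

end Density

section Extension

variable [DiscreteTopology L] [IsZLattice ℝ L] {A : smoothPeriodic L → smoothPeriodic L}
  {σ : dualLattice L → ℂ}

lemma IsFourierMultiplier.multiplier_toLp_ae_eq (hA : IsFourierMultiplier Ω A σ)
    (he : BoundedOrthonormal (characterLp (L := L) Ω)) {p : ℝ≥0∞} (hp : 1 ≤ p)
    (hmem : ∀ u : Lp ℂ p (normVol Ω), Memℓp (fun κ => σ κ * coeff (characterLp Ω) u κ) 2)
    (f : smoothPeriodic L) (hf : MemLp (f : EuclideanSpace ℝ (Fin d) → ℂ) p (normVol Ω)) :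
    he.multiplier hp σ hmem hf.toLp =ᵐ[normVol Ω] (A f : EuclideanSpace ℝ (Fin d) → ℂ) := by
  have hAf : MemLp (A f : EuclideanSpace ℝ (Fin d) → ℂ) 2 (normVol Ω) :=
    memLp_of_continuous_periodic (A f).2.1.continuous (A f).2.2 2
  have hmul : he.multiplier hp σ hmem hf.toLp = hAf.toLp := by
    refine he.multiplier_eq_of_mem_closure_span hp hmem
      (toLp_mem_closure_span_characterLp (A f).2.1.continuous (A f).2.2 hAf) fun κ => ?_
    rw [← coeff_eq_inner, coeff_congr_ae hf.coeFn_toLp, coeff_characterLp, coeff_characterLp,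
      hA f κ]
  exact hmul ▸ hAf.coeFn_toLp

theorem IsFourierMultiplier.opNorm_le_and_hasBoundedExtension (hA : IsFourierMultiplier Ω A σ)
    (he : BoundedOrthonormal (characterLp (L := L) Ω)) {p q : ℝ} (hp : 1 ≤ ENNReal.ofReal p)
    (hmem : ∀ u : Lp ℂ (ENNReal.ofReal p) (normVol Ω),
      Memℓp (fun κ => σ κ * coeff (characterLp Ω) u κ) 2)
    {K : ℝ≥0∞} (hK : K ≠ ⊤)
    (hbound : ∀ u, eLpNorm (he.multiplier hp σ hmem u) (ENNReal.ofReal q) (normVol Ω) ≤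
      K * eLpNorm u (ENNReal.ofReal p) (normVol Ω)) :
    opNorm Ω p q A ≤ K ∧ HasBoundedExtension Ω p q A := by
  have hf (f : smoothPeriodic L) :
      MemLp (f : EuclideanSpace ℝ (Fin d) → ℂ) (ENNReal.ofReal p) (normVol Ω) :=
    memLp_of_continuous_periodic f.2.1.continuous f.2.2 _
  have hlt (u : Lp ℂ (ENNReal.ofReal p) (normVol Ω)) :
      K * eLpNorm u (ENNReal.ofReal p) (normVol Ω) < ⊤ :=
    ENNReal.mul_lt_top hK.lt_top (Lp.memLp u).2
  have hmemLp (u) : MemLp (he.multiplier hp σ hmem u) (ENNReal.ofReal q) (normVol Ω) :=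
    ⟨Lp.aestronglyMeasurable _, (hbound u).trans_lt (hlt u)⟩
  refine ⟨iSup₂_le fun f _ => ENNReal.div_le_of_le_mul ?_,
    lpCodRestrict (he.multiplier hp σ hmem) hmemLp, ⟨K.toReal, fun u => ?_⟩, fun f =>
      ⟨(hf f).toLp, (hf f).coeFn_toLp, (hmemLp _).coeFn_toLp.trans
        (hA.multiplier_toLp_ae_eq he hp hmem f (hf f))⟩⟩
  · rw [← eLpNorm_congr_ae (hA.multiplier_toLp_ae_eq he hp hmem f (hf f)),
      ← eLpNorm_congr_ae (hf f).coeFn_toLp]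
    exact hbound _
  · rw [Lp.norm_def u, ← ENNReal.toReal_mul]
    exact (Lp.norm_toLp _ (hmemLp u)).trans_le (ENNReal.toReal_mono (hlt u).ne (hbound u))

end Extension

end Lattice

end LatticeFourier

end

open LatticeFourier in
theorem mainTheorem2_general {d : ℕ} {L : Submodule ℤ (EuclideanSpace ℝ (Fin d))}
    [DiscreteTopology L] [IsZLattice ℝ L] {Ω : Set (EuclideanSpace ℝ (Fin d))}
    (hΩ : IsFundamentalDomain L Ω) {A : smoothPeriodic L → smoothPeriodic L}
    {σ : dualLattice L → ℂ} (hA : IsFourierMultiplier Ω A σ) :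
    (∀ p q : ℝ, 1 < p → p ≤ 2 → 0 < q → q ≤ 2 → weakNorm σ (1 / p - 1 / 2) < ⊤ →
      opNorm Ω p q A ≤ ENNReal.ofReal √(2 / (p - 1)) * weakNorm σ (1 / p - 1 / 2) ∧
      HasBoundedExtension Ω p q A) ∧
    (∀ p q : ℝ, 2 ≤ p → 2 ≤ q → weakNorm σ (1 / q.conjExponent - 1 / 2) < ⊤ →
      opNorm Ω p q A ≤
        ENNReal.ofReal √(2 / (q.conjExponent - 1)) * weakNorm σ (1 / q.conjExponent - 1 / 2) ∧
      HasBoundedExtension Ω p q A) := by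
  have := hΩ.isProbabilityMeasure
  have he := hΩ.boundedOrthonormal_characterLp
  constructor
  · intro p q hp hp2 _ hq2 hσ
    exact hA.opNorm_le_and_hasBoundedExtension he _
      (fun u => he.memℓp_mul_coeff_of_le_two hp hp2 hσ.ne (Lp.memLp u))
      (ENNReal.mul_ne_top ENNReal.ofReal_ne_top hσ.ne)
      (he.eLpNorm_multiplier_le_of_exponents_le_two hp hp2 (by simpa) hσ.ne _)
  · intro p q hp hq hσ
    have hqq' : q.HolderConjugate q.conjExponent := .conjExponent (by linarith)
    have hexp : 0 ≤ 1 / q.conjExponent - 1 / 2 := sub_nonneg.2 <|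
      one_div_le_one_div_of_le hqq'.symm.pos (holderConjugate_le_two hqq' hq)
    have hp' : 2 ≤ ENNReal.ofReal p := by simpa
    exact hA.opNorm_le_and_hasBoundedExtension he _
      (fun u => he.memℓp_mul_coeff_of_enorm_le hσ.ne (enorm_le_weakQuasinorm hexp)
        ((Lp.memLp u).mono_exponent hp'))
      (ENNReal.mul_ne_top ENNReal.ofReal_ne_top hσ.ne)
      (he.eLpNorm_multiplier_le_of_two_le_exponents hqq' hq hσ.ne hp' _)

theorem mainTheorem2 (p q : ℝ) (hp : 1 < p) (hq : 1 < q) :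
    (p ≤ 2 → q ≤ 2 → ∃ C : ℝ≥0, ∀ (d : ℕ) (L : Submodule ℤ (EuclideanSpace ℝ (Fin d)))
      [DiscreteTopology L] [IsZLattice ℝ L] (Ω : Set (EuclideanSpace ℝ (Fin d)))
      (_ : LatticeFourier.IsFundamentalDomain L Ω)
      (A : LatticeFourier.smoothPeriodic L → LatticeFourier.smoothPeriodic L)
      (σ : LatticeFourier.dualLattice L → ℂ) (_ : LatticeFourier.IsFourierMultiplier Ω A σ)
      (_ : LatticeFourier.weakNorm σ (1 / p - 1 / 2) < ⊤),
      LatticeFourier.opNorm Ω p q A ≤ C * LatticeFourier.weakNorm σ (1 / p - 1 / 2) ∧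
      LatticeFourier.HasBoundedExtension Ω p q A) ∧
    (2 ≤ p → 2 ≤ q → ∃ C : ℝ≥0, ∀ (d : ℕ) (L : Submodule ℤ (EuclideanSpace ℝ (Fin d)))
      [DiscreteTopology L] [IsZLattice ℝ L] (Ω : Set (EuclideanSpace ℝ (Fin d)))
      (_ : LatticeFourier.IsFundamentalDomain L Ω)
      (A : LatticeFourier.smoothPeriodic L → LatticeFourier.smoothPeriodic L)
      (σ : LatticeFourier.dualLattice L → ℂ) (_ : LatticeFourier.IsFourierMultiplier Ω A σ)
      (_ : LatticeFourier.weakNorm σ (1 / q.conjExponent - 1 / 2) < ⊤),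
      LatticeFourier.opNorm Ω p q A ≤
        C * LatticeFourier.weakNorm σ (1 / q.conjExponent - 1 / 2) ∧
      LatticeFourier.HasBoundedExtension Ω p q A) := by
  exact ⟨fun hp2 hq2 => ⟨_, fun _ _ _ _ _ hΩ _ _ hA =>
      (mainTheorem2_general hΩ hA).1 p q hp hp2 (one_pos.trans hq) hq2⟩,
    fun hp2 hq2 => ⟨_, fun _ _ _ _ _ hΩ _ _ hA => (mainTheorem2_general hΩ hA).2 p q hp2 hq2⟩⟩
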